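/- A $K$-outcome measurement on a finite-dimensional complex Hilbert space $\mathcal H$ is a tuple $(M_a)_{a=1}^K$ of positive semidefinite operators on $\mathcal H$ with $\sum_a M_a=I$. An $N$-input $K$-output bipartite strategy $\mathcal S=(|\psi\rangle;\mathcal M_1,\dots,\mathcal M_N;\mathcal N_1,\dots,\mathcal N_N)$ consists of finite-dimensional Hilbert spaces $\mathcal H_A,\mathcal H_B$, a unit vector $|\psi\rangle\in\mathcal H_A\otimes\mathcal H_B$, and $K$-outcome measurements $\mathcal M_i=(\mathcal M_{i,a})_a$ on $\mathcal H_A$ and $\mathcal N_j=(\mathcal N_{j,b})_b$ on $\mathcal H_B$. Its correlation is $p(a,b|i,j)=\langle\psi|\mathcal M_{i,a}\otimes\mathcal N_{j,b}|\psi\rangle$. A strategy $\widetilde{\mathcal S}$ is a local dilation of $\mathcal S$ if there are finite-dimensional Hilbert spaces $\mathcal K_A,\mathcal K_B$, a unit vector $|\mathrm{aux}\rangle\in\mathcal K_A\otimes\mathcal K_B$ and isometries $U_A:\mathcal H_A\to\widetilde{\mathcal H}_A\otimes\mathcal K_A$, $U_B:\mathcal H_B\to\widetilde{\mathcal H}_B\otimes\mathcal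 K_B$ such that, up to the canonical reordering of tensor factors, $$(U_A\otimes U_B)(\mathcal M_{i,a}\otimes\mathcal N_{j,b})|\psi\rangle=(\widetilde{\mathcal M}_{i,a}\otimes\widetilde{\mathcal N}_{j,b})|\widetilde\psi\rangle\otimes|\mathrm{aux}\rangle\qquad\text{for all }a,b,i,j.$$ A strategy is self-tested by its correlation if it is a local dilation of every strategy with the same correlation. Let $|\phi_n\rangle=\frac1{\sqrt n}\sum_{i=1}^n|i\rangle|i\rangle\in\mathbb C^n\otimes\mathbb C^n$ be the maximally entangled state of local dimension $n$. **Corollary 5.4.** Let $n\ge1$ be an integer. (a) There is a 4-input 2-output bipartite strategy with state $|\phi_n\rangle$ that is self-tested by its correlation. (b) Let $P\in M_n(\mathbb C)$ be an orthogonal projection with $$\operatorname{rank}P\in\left\{\left\lceil\tfrac n2\right\rceil,\ \left\lfloor\tfrac n2\right\rfloor-(-1)^n,\ \left\lceil\tfrac n2\right\rceil+(-1)^n\right\}.$$ Then the binary projective measurement $(P,I-P)$ is one of the measurements of the first party in some 4-input 2-output bipartite strategy with state $|\phi_n\rangle$ that is self-tested by its correlation; likewise for the second party. -/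

import Mathlib

open scoped TensorProduct

noncomputable section

/-- A `K`-outcome positive operator-valued measure on a finite-dimensional Hilbert space `H`. -/
structure POVM (K : ℕ) (H : Type) [NormedAddCommGroup H] [InnerProductSpace ℂ H] where
  effect : Fin K → H →ₗ[ℂ] H
  isPositive : ∀ a, (effect a).IsPositive
  sum_effect : ∑ a, effect a = 1

/-- `M` is the binary projective measurement `(P, I - P)` on `ℂⁿ`. -/
def POVM.IsBinaryPVM {n : ℕ} (M : POVM 2 (EuclideanSpace ℂ (Fin n)))
    (P : Matrix (Fin n) (Fin n) ℂ) : Prop :=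
  M.effect 0 = Matrix.toEuclideanLin P ∧ M.effect 1 = Matrix.toEuclideanLin (1 - P)

/-- A bipartite quantum strategy on `HA ⊗ HB`: the first party has `NA` measurements with `KA`
outcomes each, the second party has `NB` measurements with `KB` outcomes each. -/
structure BipartiteStrategy (NA NB KA KB : ℕ) (HA HB : Type)
    [NormedAddCommGroup HA] [InnerProductSpace ℂ HA]
    [NormedAddCommGroup HB] [InnerProductSpace ℂ HB] where
  state : HA ⊗[ℂ] HB
  norm_state : ‖state‖ = 1
  measA : Fin NA → POVM KA HA
  measB : Fin NB → POVM KB HB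

namespace BipartiteStrategy

section

variable {NA NB KA KB : ℕ}
variable {HA HB : Type}
  [NormedAddCommGroup HA] [InnerProductSpace ℂ HA]
  [NormedAddCommGroup HB] [InnerProductSpace ℂ HB]
variable {GA GB : Type}
  [NormedAddCommGroup GA] [InnerProductSpace ℂ GA]
  [NormedAddCommGroup GB] [InnerProductSpace ℂ GB]

/-- The vector `(M_{i,a} ⊗ N_{j,b}) |ψ⟩`. -/
def outcomeVec (S : BipartiteStrategy NA NB KA KB HA HB)
    (a : Fin KA) (b : Fin KB) (i : Fin NA) (j : Fin NB) : HA ⊗[ℂ] HB :=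
  TensorProduct.map ((S.measA i).effect a) ((S.measB j).effect b) S.state

/-- The correlation `p(a,b|i,j) = ⟨ψ| M_{i,a} ⊗ N_{j,b} |ψ⟩`. -/
def correlation (S : BipartiteStrategy NA NB KA KB HA HB)
    (a : Fin KA) (b : Fin KB) (i : Fin NA) (j : Fin NB) : ℂ :=
  inner ℂ S.state (S.outcomeVec a b i j)

/-- `T` (on `GA ⊗ GB`) is a local dilation of `S` (on `HA ⊗ HB`). The identification
`(GA ⊗ LA) ⊗ (GB ⊗ LB) ≡ (GA ⊗ GB) ⊗ (LA ⊗ LB)` is `TensorProduct.tensorTensorTensorComm`. -/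
def IsLocalDilation (T : BipartiteStrategy NA NB KA KB GA GB)
    (S : BipartiteStrategy NA NB KA KB HA HB) : Prop :=
  ∃ (LA LB : Type)
    (_ : NormedAddCommGroup LA) (_ : InnerProductSpace ℂ LA) (_ : FiniteDimensional ℂ LA)
    (_ : NormedAddCommGroup LB) (_ : InnerProductSpace ℂ LB) (_ : FiniteDimensional ℂ LB)
    (aux : LA ⊗[ℂ] LB) (UA : HA →ₗᵢ[ℂ] GA ⊗[ℂ] LA) (UB : HB →ₗᵢ[ℂ] GB ⊗[ℂ] LB),
    ‖aux‖ = 1 ∧ ∀ a b i j,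
      TensorProduct.map UA.toLinearMap UB.toLinearMap (S.outcomeVec a b i j) =
        TensorProduct.tensorTensorTensorComm ℂ GA GB LA LB (T.outcomeVec a b i j ⊗ₜ[ℂ] aux)

/-- `T` is self-tested by its correlation: it is a local dilation of every strategy, on arbitrary
finite-dimensional Hilbert spaces, with the same correlation. (Every finite-dimensional Hilbert
space is isometric to one in the universe `Type`.) -/
def IsSelfTested (T : BipartiteStrategy NA NB KA KB GA GB) : Prop :=
  ∀ (HA HB : Type)
    [NormedAddCommGroup HA] [InnerProductSpace ℂ HA] [FiniteDimensional ℂ HA]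
    [NormedAddCommGroup HB] [InnerProductSpace ℂ HB] [FiniteDimensional ℂ HB]
    (S : BipartiteStrategy NA NB KA KB HA HB),
    S.correlation = T.correlation → T.IsLocalDilation S

end

end BipartiteStrategy

/-- The maximally entangled state `n^{-1/2} ∑ᵢ |eᵢ⟩|eᵢ⟩` of local dimension `n` in an orthonormal
basis `e`. -/
def maxEntangledVec {n : ℕ} {H : Type} [NormedAddCommGroup H] [InnerProductSpace ℂ H]
    (e : OrthonormalBasis (Fin n) ℂ H) : H ⊗[ℂ] H :=
  ((Real.sqrt n : ℂ))⁻¹ • ∑ i : Fin n, e i ⊗ₜ[ℂ] e i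

/-- An `N`-input `K`-output strategy with local Hilbert spaces `ℂⁿ`. -/
abbrev SquareStrategy (N K n : ℕ) : Type :=
  BipartiteStrategy N N K K (EuclideanSpace ℂ (Fin n)) (EuclideanSpace ℂ (Fin n))

/-- The state of `S` is the canonical maximally entangled state `n^{-1/2} ∑ᵢ |i⟩|i⟩` in
`ℂⁿ ⊗ ℂⁿ`. -/
def SquareStrategy.HasMaxEntangledState {N K n : ℕ} (S : SquareStrategy N K n) : Prop :=
  S.state = maxEntangledVec (EuclideanSpace.basisFun (Fin n) ℂ)

end

/-!
The strategies are built from four projections `P₁, …, P₄` on `ℂⁿ` with `P₁ + ⋯ + P₄ = 2 - 1/n`.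
Put `C = P₁ + P₂ - 1`, `D = P₁ - P₂`, `G = P₃ - P₄`. That the `Pᵢ` are projections with this sum
means that `D` anticommutes with `C`, `G` anticommutes with `C + 1/n`, and
`C² + D² = (C + 1/n)² + G² = 1` (`pathRelations_of_projections`). So `D` sends the eigenvalue `c` of
`C` to `-c` and `G` sends it to `-2/n - c`. Starting from a vector with `C = 0`, `D = 1` and
applying `G, D, G, …` in turn, one passes through `n` distinct eigenvalues of `C` until the next
operator vanishes on the vector: its square is `1 - (m/n)²` at the `m`-th step. In the basis of these
vectors `C` is diagonal and `D`, `G` are weighted matchings of the edges of a path, with a loop of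
weight `1` at the starting site. This gives the real symmetric `idealProjection n`. Both parties
measure it on the maximally entangled state.

Let another strategy on the state `ψ` have the same correlation. Equal questions get equal
answers, so the effects `Eᵢ`, `Fᵢ` of the parties satisfy `Eᵢψ = Fᵢψ` and `Eᵢ²ψ = Eᵢψ`, and
`‖(∑ Eᵢ - 2 + 1/n)ψ‖²` is a function of the correlation, hence zero. After restriction to the
local supports of `ψ` (`exists_support`) these are relations between operators, and the vector state
of `ψ` is a faithful trace `τ` on the algebra generated by the `Eᵢ` because each of its elements
is mirrored by one of the other party (`Mirror`). The relations alone have several irreducible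
representations; the value `τ(D) = 1/n` selects one. Indeed `D` is traceless off the kernel of
`C`, so the projection `Q` onto the vectors with `C = 0`, `D = 1` has trace at least `1/n`, and the
ladder of `n` words that start with `Q` consists of partial isometries `s₀, …, sₙ₋₁` with orthogonal
ranges of equal trace. Therefore `∑ sₘ sₘ* = 1` (`PathRelations.sum_ladder`). The map
`v ↦ ∑ eₘ ⊗ sₘ* v` is then an isometry that intertwines the `Eᵢ` with the ideal projections, and the
product of the maps of the two parties sends `ψ` to `∑ eₘ ⊗ eₘ ⊗ Qψ`
(`exists_isometry_of_fullSupport`).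

Local unitaries and exchange of outcomes preserve self-testing. The ranks of `P₁`, `P₂` and `1 - P₂`,
computed from traces, cover the ranks in question, and projections of equal rank are unitarily
equivalent.
-/

/-! ### Words along a path in a star algebra -/

/-- The even-labelled edge at the site `m` of the path `0 - 1 - 2 - ⋯`, where the edge `e ≥ 1` joins
`e - 1` and `e`, and the edge `0` is a loop at `0`. -/
def evenEdge (m : ℕ) : ℕ := 2 * ((m + 1) / 2)

/-- The odd-labelled edge at the site `m` of the path `0 - 1 - 2 - ⋯`. -/
def oddEdge (m : ℕ) : ℕ := 2 * (m / 2) + 1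

/-- The weight `√(1 - (e/n)²)` of the edge `e`. It is `1` on the loop `e = 0` and, for `n ≥ 1`,
it vanishes for `e ≥ n`, so the path is cut after the site `n - 1`. -/
noncomputable def edgeWeight (n e : ℕ) : ℝ := Real.sqrt (1 - (e / n : ℝ) ^ 2)

/-- The number `± evenEdge m / n` attached to the site `m`, with the sign `+` at even sites. -/
noncomputable def siteValue (n m : ℕ) : ℝ := (-1) ^ m * (evenEdge m : ℝ) / n

section arithmetic

variable {n m : ℕ}

lemma evenEdge_of_even (h : Even m) : evenEdge m = m := by
  obtain ⟨k, rfl⟩ := h; unfold evenEdge; omega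

lemma evenEdge_of_odd (h : Odd m) : evenEdge m = m + 1 := by
  obtain ⟨k, rfl⟩ := h; unfold evenEdge; omega

lemma oddEdge_of_even (h : Even m) : oddEdge m = m + 1 := by
  obtain ⟨k, rfl⟩ := h; unfold oddEdge; omega

lemma oddEdge_of_odd (h : Odd m) : oddEdge m = m := by
  obtain ⟨k, rfl⟩ := h; unfold oddEdge; omega

lemma siteValue_of_even (h : Even m) : siteValue n m = m / n := by
  simp [siteValue, h.neg_one_pow, evenEdge_of_even h]

lemma siteValue_of_odd (h : Odd m) : siteValue n m = -((m + 1 : ℝ) / n) := by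
  simp [siteValue, h.neg_one_pow, evenEdge_of_odd h]; ring

lemma edgeWeight_zero : edgeWeight n 0 = 1 := by simp [edgeWeight]

lemma edgeWeight_self (hn : 1 ≤ n) : edgeWeight n n = 0 := by
  have : (n : ℝ) ≠ 0 := by positivity
  simp [edgeWeight, this]

lemma edgeWeight_sq (hn : 1 ≤ n) (h : m ≤ n) : edgeWeight n m ^ 2 = 1 - (m / n : ℝ) ^ 2 := by
  have hn' : (0 : ℝ) < n := by positivity
  have h1 : (m / n : ℝ) ≤ 1 := by rw [div_le_one hn']; exact_mod_cast h
  have h0 : (0 : ℝ) ≤ m / n := by positivity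
  rw [edgeWeight, Real.sq_sqrt]
  nlinarith

lemma edgeWeight_ne_zero (h : m < n) : edgeWeight n m ≠ 0 := by
  have hn' : (0 : ℝ) < n := by exact_mod_cast (by omega : 0 < n)
  have h1 : (m / n : ℝ) < 1 := by rw [div_lt_one hn']; exact_mod_cast h
  have h0 : (0 : ℝ) ≤ m / n := by positivity
  apply (Real.sqrt_pos.2 _).ne'
  nlinarith

lemma siteValue_injective (hn : 1 ≤ n) : Function.Injective (siteValue n) := by
  have hn' : (0 : ℝ) < n := by positivity
  intro a b h
  rcases Nat.even_or_odd a with ha | ha <;> rcases Nat.even_or_odd b with hb | hb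
  · rw [siteValue_of_even ha, siteValue_of_even hb, div_left_inj' hn'.ne'] at h
    exact_mod_cast h
  · rw [siteValue_of_even ha, siteValue_of_odd hb] at h
    have h1 : (0 : ℝ) ≤ a / n := by positivity
    have h2 : (0 : ℝ) < (b + 1) / n := by positivity
    linarith
  · rw [siteValue_of_odd ha, siteValue_of_even hb] at h
    have h1 : (0 : ℝ) ≤ b / n := by positivity
    have h2 : (0 : ℝ) < (a + 1) / n := by positivity
    linarith
  · rw [siteValue_of_odd ha, siteValue_of_odd hb, neg_inj, div_left_inj' hn'.ne'] at h
    have : (a : ℝ) = b := by linarith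
    exact_mod_cast this

end arithmetic

section kernel

variable {R : Type*} [Ring R] [StarRing R]

lemma kernelProjection_star_mul_self {C X : R} (hC : star C = C) (hX : C * X = X * C)
    (hCX : C * X * C = C) : star (1 - C * X) * (1 - C * X) = 1 - C * X := by
  have h0 : C * (1 - C * X) = 0 := by rw [mul_sub, mul_one, hX, ← mul_assoc, hCX, sub_self]
  rw [star_sub, star_one, star_mul, hC, sub_mul, one_mul, mul_assoc, h0, mul_zero, sub_zero]

lemma kernelProjection_star {C X : R} (hC : star C = C) (hX : C * X = X * C)
    (hCX : C * X * C = C) : star (1 - C * X) = 1 - C * X := by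
  rw [← kernelProjection_star_mul_self hC hX hCX, star_mul, star_star]

end kernel

section ladder

variable {R : Type*} [Ring R] [Algebra ℂ R]

variable {n : ℕ}

/-- The operator attached to the edge `e`: `D` if `e` is even and `G` if `e` is odd. -/
def edgeOp (D G : R) (e : ℕ) : R := if Even e then D else G

/-- The normalised word that transports the loop projection `Q` from the site `0` to the site `m`.
Since `edgeWeight n n = 0` and `0⁻¹ = 0`, it is `0` for `m ≥ n ≥ 1`. -/
noncomputable def ladder (n : ℕ) (D G Q : R) : ℕ → R
  | 0 => Q
  | m + 1 => (((edgeWeight n (m + 1))⁻¹ : ℝ) : ℂ) • (edgeOp D G (m + 1) * ladder n D G Q m)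

lemma ladder_of_le {D G Q : R} (hn : 1 ≤ n) {m : ℕ} (h : n ≤ m) : ladder n D G Q m = 0 := by
  induction m, h using Nat.le_induction with
  | base =>
    obtain ⟨k, rfl⟩ : ∃ k, n = k + 1 := ⟨n - 1, by omega⟩
    simp [ladder, edgeWeight_self]
  | succ m _ ih => simp [ladder, ih]

variable [StarRing R] {C D G Q : R}

/-- The relations between `C = P₁ + P₂ - 1`, `D = P₁ - P₂` and `G = P₃ - P₄` that express that
`P₁, …, P₄` are projections with sum `2 - 1/n`. -/
structure PathRelations (n : ℕ) (C D G : R) : Prop where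
  star_C : star C = C
  star_D : star D = D
  star_G : star G = G
  anti_D : C * D = -(D * C)
  sq_D : C * C + D * D = 1
  anti_G : C * G = -(G * C) - ((2 / n : ℝ) : ℂ) • G
  sq_G : (C + ((1 / n : ℝ) : ℂ) • 1) * (C + ((1 / n : ℝ) : ℂ) • 1) + G * G = 1

/-- `Q` is a projection onto the joint eigenspace where `C = 0` and `D = 1`. -/
structure IsLoopProjection (C D Q : R) : Prop where
  star_eq : star Q = Q
  mul_self : Q * Q = Q
  C_mul : C * Q = 0
  D_mul : D * Q = Q

lemma PathRelations.star_edgeOp (h : PathRelations n C D G) (e : ℕ) :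
    star (edgeOp D G e) = edgeOp D G e := by
  unfold edgeOp; split_ifs <;> simp [h.star_D, h.star_G]

lemma PathRelations.C_mul_ladder (h : PathRelations n C D G) (hQ : IsLoopProjection C D Q)
    (m : ℕ) : C * ladder n D G Q m = (siteValue n m : ℂ) • ladder n D G Q m := by
  induction m with
  | zero => simp [ladder, hQ.C_mul, siteValue_of_even]
  | succ m ih =>
    rw [ladder, mul_smul_comm, smul_comm]
    congr 1
    rw [← mul_assoc]
    rcases Nat.even_or_odd (m + 1) with he | ho
    · have hm : Odd m := by grind
      rw [edgeOp, if_pos he, h.anti_D, neg_mul, mul_assoc, ih, siteValue_of_odd hm,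
        siteValue_of_even he, mul_smul_comm, ← neg_smul]
      congr 1; push_cast; ring
    · have hm : Even m := by grind
      rw [edgeOp, if_neg (by simpa using ho), h.anti_G, sub_mul, neg_mul, mul_assoc, ih,
        siteValue_of_even hm, siteValue_of_odd ho, mul_smul_comm, smul_mul_assoc, ← neg_smul,
        ← sub_smul]
      congr 1; push_cast; ring

/-- At the site `m` the square of the operator on the next edge is the square of its weight. -/
lemma PathRelations.edgeOp_sq_mul_ladder (hn : 1 ≤ n) (h : PathRelations n C D G)
    (hQ : IsLoopProjection C D Q) {m : ℕ} (hm : m < n) :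
    edgeOp D G (m + 1) * (edgeOp D G (m + 1) * ladder n D G Q m) =
      ((edgeWeight n (m + 1) ^ 2 : ℝ) : ℂ) • ladder n D G Q m := by
  have hC := h.C_mul_ladder hQ m
  have hn' : (n : ℂ) ≠ 0 := by exact_mod_cast (by omega : n ≠ 0)
  rw [edgeWeight_sq hn (by omega), ← mul_assoc]
  rcases Nat.even_or_odd (m + 1) with he | ho
  · have hm : Odd m := by grind
    rw [edgeOp, if_pos he, eq_sub_of_add_eq' h.sq_D, sub_mul, one_mul, mul_assoc, hC,
      mul_smul_comm, hC, smul_smul, siteValue_of_odd hm]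
    conv_lhs => enter [1]; rw [← one_smul ℂ (ladder n D G Q m)]
    rw [← sub_smul]
    congr 1; push_cast; ring
  · have hm : Even m := by grind
    have hC' : (C + ((1 / n : ℝ) : ℂ) • 1) * ladder n D G Q m =
        (((m + 1) / n : ℝ) : ℂ) • ladder n D G Q m := by
      rw [add_mul, hC, smul_mul_assoc, one_mul, ← add_smul, siteValue_of_even hm]
      congr 1; push_cast; ring
    rw [edgeOp, if_neg (by simpa using ho), eq_sub_of_add_eq' h.sq_G, sub_mul, one_mul, mul_assoc,
      hC', mul_smul_comm, hC', smul_smul]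
    conv_lhs => enter [1]; rw [← one_smul ℂ (ladder n D G Q m)]
    rw [← sub_smul]
    congr 1; push_cast; ring

lemma PathRelations.edgeOp_mul_ladder_succ (hn : 1 ≤ n) (h : PathRelations n C D G)
    (hQ : IsLoopProjection C D Q) {m : ℕ} (hm : m < n) :
    edgeOp D G (m + 1) * ladder n D G Q (m + 1) =
      (edgeWeight n (m + 1) : ℂ) • ladder n D G Q m := by
  by_cases hw : edgeWeight n (m + 1) = 0
  · simp [ladder, hw]
  · rw [ladder, mul_smul_comm, h.edgeOp_sq_mul_ladder hn hQ hm, smul_smul]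
    have : (edgeWeight n (m + 1) : ℂ) ≠ 0 := by exact_mod_cast hw
    congr 1; push_cast; field_simp

lemma PathRelations.edgeOp_mul_ladder (hn : 1 ≤ n) (h : PathRelations n C D G)
    (hQ : IsLoopProjection C D Q) (proper : ∀ x : R, star x * x = 0 → x = 0) {m : ℕ} (hm : m < n) :
    edgeOp D G (m + 1) * ladder n D G Q m =
      (edgeWeight n (m + 1) : ℂ) • ladder n D G Q (m + 1) := by
  rcases Nat.lt_or_ge (m + 1) n with hlt | hge
  · have : (edgeWeight n (m + 1) : ℂ) ≠ 0 := by exact_mod_cast edgeWeight_ne_zero hlt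
    rw [ladder, smul_smul]
    push_cast
    rw [mul_inv_cancel₀ this, one_smul]
  · obtain rfl : m + 1 = n := by omega
    rw [ladder_of_le hn le_rfl, smul_zero]
    apply proper
    rw [star_mul, h.star_edgeOp, mul_assoc, h.edgeOp_sq_mul_ladder hn hQ hm, edgeWeight_self hn]
    simp

lemma PathRelations.star_ladder_mul_self [StarModule ℂ R] (hn : 1 ≤ n) (h : PathRelations n C D G)
    (hQ : IsLoopProjection C D Q) {m : ℕ} (hm : m < n) :
    star (ladder n D G Q m) * ladder n D G Q m = Q := by
  induction m with
  | zero => rw [ladder, hQ.star_eq, hQ.mul_self]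
  | succ m ih =>
    have hw : (edgeWeight n (m + 1) : ℂ) ≠ 0 := by exact_mod_cast edgeWeight_ne_zero hm
    conv_lhs => enter [1]; rw [ladder]
    rw [star_smul, star_mul, h.star_edgeOp, smul_mul_assoc, mul_assoc,
      h.edgeOp_mul_ladder_succ hn hQ (by omega), mul_smul_comm, ih (by omega), smul_smul]
    simp [hw]

lemma PathRelations.star_ladder_mul_ladder [StarModule ℂ R] (hn : 1 ≤ n) (h : PathRelations n C D G)
    (hQ : IsLoopProjection C D Q) {j k : ℕ} (hjk : j ≠ k) :
    star (ladder n D G Q j) * ladder n D G Q k = 0 := by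
  have h1 : star (ladder n D G Q j) * (C * ladder n D G Q k) =
      (siteValue n j : ℂ) • (star (ladder n D G Q j) * ladder n D G Q k) := by
    rw [← mul_assoc]
    have := congrArg star (h.C_mul_ladder hQ j)
    rw [star_mul, h.star_C, star_smul] at this
    rw [this]; simp
  rw [h.C_mul_ladder hQ k, mul_smul_comm, ← sub_eq_zero, ← sub_smul] at h1
  refine (smul_eq_zero.1 h1).resolve_left ?_
  refine sub_ne_zero.2 ?_
  exact_mod_cast (siteValue_injective hn).ne hjk.symm

lemma PathRelations.D_mul_ladder (hn : 1 ≤ n) (h : PathRelations n C D G)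
    (hQ : IsLoopProjection C D Q) (proper : ∀ x : R, star x * x = 0 → x = 0) {m : ℕ} (hm : m < n) :
    D * ladder n D G Q m = (edgeWeight n (evenEdge m) : ℂ) •
      ladder n D G Q (2 * evenEdge m - 1 - m) := by
  rcases Nat.even_or_odd m with he | ho
  · rw [evenEdge_of_even he]
    rcases m with _ | m
    · simp [ladder, hQ.D_mul, edgeWeight_zero]
    · have := h.edgeOp_mul_ladder_succ hn hQ (m := m) (by omega)
      rw [edgeOp, if_pos he] at this
      rw [this]; congr 2; omega
  · have := h.edgeOp_mul_ladder hn hQ proper hm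
    rw [edgeOp, if_pos (by grind)] at this
    rw [evenEdge_of_odd ho, this]; congr 2; omega

lemma PathRelations.G_mul_ladder (hn : 1 ≤ n) (h : PathRelations n C D G)
    (hQ : IsLoopProjection C D Q) (proper : ∀ x : R, star x * x = 0 → x = 0) {m : ℕ} (hm : m < n) :
    G * ladder n D G Q m = (edgeWeight n (oddEdge m) : ℂ) •
      ladder n D G Q (2 * oddEdge m - 1 - m) := by
  rcases Nat.even_or_odd m with he | ho
  · have := h.edgeOp_mul_ladder hn hQ proper hm
    rw [edgeOp, if_neg (by grind)] at this
    rw [oddEdge_of_even he, this]; congr 2; omega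
  · rw [oddEdge_of_odd ho]
    rcases m with _ | m
    · simp at ho
    · have := h.edgeOp_mul_ladder_succ hn hQ (m := m) (by omega)
      rw [edgeOp, if_neg (by grind)] at this
      rw [this]; congr 2; omega

/-- If `X` is a generalised inverse of `C` that commutes with `C`, then `1 - C X` is the projection
onto the kernel of `C`, on which `D` acts as a symmetry; this is its spectral projection for the
eigenvalue `1`. -/
noncomputable def loopProjection (C D X : R) : R :=
  ((1 / 2 : ℝ) : ℂ) • ((1 - C * X) + D * (1 - C * X))

lemma PathRelations.D_mul_kernelProjection {X : R} (h : PathRelations n C D G)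
    (hX : C * X = X * C) (hCX : C * X * C = C) :
    D * (1 - C * X) = (1 - C * X) * D := by
  have h0 : C * (1 - C * X) = 0 := by rw [mul_sub, mul_one, hX, ← mul_assoc, hCX, sub_self]
  have hs := kernelProjection_star h.star_C hX hCX
  have h1 : (1 - C * X) * (D * (1 - C * X)) = D * (1 - C * X) := by
    conv_lhs => rw [hX]
    rw [sub_mul, one_mul, mul_assoc, ← mul_assoc C, h.anti_D, neg_mul, mul_assoc D, ← hX, h0]
    simp
  have h2 := congrArg star h1
  rw [star_mul, star_mul, hs, h.star_D, mul_assoc, h1] at h2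
  exact h2

lemma PathRelations.isLoopProjection [StarModule ℂ R] {X : R} (h : PathRelations n C D G)
    (hX : C * X = X * C) (hCX : C * X * C = C) :
    IsLoopProjection C D (loopProjection C D X) := by
  have h0 : C * (1 - C * X) = 0 := by rw [mul_sub, mul_one, hX, ← mul_assoc, hCX, sub_self]
  have hs := kernelProjection_star h.star_C hX hCX
  have hK := kernelProjection_star_mul_self h.star_C hX hCX
  have hD := h.D_mul_kernelProjection hX hCX
  rw [hs] at hK
  rw [loopProjection]
  generalize 1 - C * X = K at *
  have hDD : D * (D * K) = K := by
    rw [← mul_assoc, eq_sub_of_add_eq' h.sq_D, sub_mul, one_mul, mul_assoc, h0]; simp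
  have hCD : C * (D * K) = 0 := by rw [← mul_assoc, h.anti_D, neg_mul, mul_assoc, h0]; simp
  have hKD : K * (D * K) = D * K := by rw [← mul_assoc, ← hD, mul_assoc, hK]
  have hDK : D * K * (D * K) = K := by rw [mul_assoc, hKD, hDD]
  refine ⟨?_, ?_, ?_, ?_⟩
  · rw [star_smul, star_add, star_mul, hs, h.star_D, ← hD]; simp
  · rw [smul_mul_smul_comm, add_mul, mul_add, mul_add, hK, hKD, hDK, mul_assoc D K K, hK,
      add_comm (D * K) K, ← two_smul ℂ (K + D * K), smul_smul]
    congr 1; push_cast; ring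
  · rw [mul_smul_comm, mul_add, h0, hCD]; simp
  · rw [mul_smul_comm, mul_add, hDD, add_comm]

end ladder

/-! ### The trace of the ladder -/

section trace

variable {R : Type*} [Ring R] [StarRing R] [Algebra ℂ R] [StarModule ℂ R]
variable {n : ℕ} {C D G Q X : R}

/-- A faithful state on `R` that has the elements `C`, `D`, `G` in its centralizer. -/
structure IsCentralizedBy (τ : R →ₗ[ℂ] ℂ) (C D G : R) : Prop where
  map_one : τ 1 = 1
  nonneg : ∀ x, 0 ≤ (τ (star x * x)).re
  faithful : ∀ x, (τ (star x * x)).re ≤ 0 → x = 0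
  comm_C : ∀ x, τ (C * x) = τ (x * C)
  comm_D : ∀ x, τ (D * x) = τ (x * D)
  comm_G : ∀ x, τ (G * x) = τ (x * G)

/-- Off the kernel of `C` the trace of `D` vanishes because `C` and `D` anticommute. -/
lemma PathRelations.trace_le_loopProjection {τ : R →ₗ[ℂ] ℂ} (h : PathRelations n C D G)
    (hτ : IsCentralizedBy τ C D G) (hX : C * X = X * C) (hCX : C * X * C = C) :
    (τ D).re ≤ (τ (loopProjection C D X)).re := by
  have hQ := h.isLoopProjection hX hCX
  have h0 : C * (1 - C * X) = 0 := by rw [mul_sub, mul_one, hX, ← mul_assoc, hCX, sub_self]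
  have hs := kernelProjection_star h.star_C hX hCX
  have hK := kernelProjection_star_mul_self h.star_C hX hCX
  have hD := h.D_mul_kernelProjection hX hCX
  have hoff : τ (D * (C * X)) = 0 := by
    have h1 : τ (D * (C * X)) = -τ (D * (C * X)) := by
      conv_lhs => rw [← mul_assoc, ← neg_neg (D * C), ← h.anti_D, neg_mul, map_neg, mul_assoc,
        hτ.comm_C, mul_assoc, ← hX]
    exact self_eq_neg.1 h1
  have hDeq : τ D = τ (D * (1 - C * X)) := by rw [mul_sub, mul_one, map_sub, hoff, sub_zero]
  rw [hs] at hK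
  rw [hDeq, loopProjection]
  generalize 1 - C * X = K at *
  have hDD : D * (D * K) = K := by
    rw [← mul_assoc, eq_sub_of_add_eq' h.sq_D, sub_mul, one_mul, mul_assoc, h0]; simp
  have hKD : K * (D * K) = D * K := by rw [← mul_assoc, ← hD, mul_assoc, hK]
  have hDK : D * K * (D * K) = K := by rw [mul_assoc, hKD, hDD]
  have hpos := hτ.nonneg (K - D * K)
  have hsq : star (K - D * K) * (K - D * K) = (2 : ℂ) • K - (2 : ℂ) • (D * K) := by
    rw [star_sub, star_mul, hs, h.star_D, ← hD, sub_mul, mul_sub, mul_sub, hK, hKD, hDK,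
      mul_assoc D K K, hK, two_smul, two_smul]
    abel
  rw [hsq] at hpos
  simp only [map_sub, map_smul, map_add, smul_eq_mul] at hpos ⊢
  have e1 : (2 * τ K - 2 * τ (D * K)).re = 2 * (τ K).re - 2 * (τ (D * K)).re := by simp
  have e2 : (((1 / 2 : ℝ) : ℂ) * (τ K + τ (D * K))).re = 1 / 2 * ((τ K).re + (τ (D * K)).re) := by
    rw [Complex.re_ofReal_mul, Complex.add_re]
  rw [e1] at hpos
  rw [e2]
  linarith

lemma PathRelations.trace_ladder (hn : 1 ≤ n) {τ : R →ₗ[ℂ] ℂ} (h : PathRelations n C D G)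
    (hτ : IsCentralizedBy τ C D G) (hQ : IsLoopProjection C D Q) {m : ℕ} (hm : m < n) :
    τ (ladder n D G Q m * star (ladder n D G Q m)) = τ Q := by
  induction m with
  | zero => rw [ladder, hQ.star_eq, hQ.mul_self]
  | succ m ih =>
    have hw : (edgeWeight n (m + 1) : ℂ) ≠ 0 := by exact_mod_cast edgeWeight_ne_zero hm
    have hc : ∀ x, τ (edgeOp D G (m + 1) * x) = τ (x * edgeOp D G (m + 1)) := by
      intro x; unfold edgeOp; split_ifs; exacts [hτ.comm_D x, hτ.comm_G x]
    have hsq := congrArg star (h.edgeOp_sq_mul_ladder hn hQ (m := m) (by omega))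
    rw [star_mul, star_mul, h.star_edgeOp, star_smul] at hsq
    rw [ladder, star_smul, star_mul, h.star_edgeOp, smul_mul_smul_comm, map_smul, mul_assoc, hc,
      mul_assoc, hsq, mul_smul_comm, map_smul, ih (by omega), smul_smul]
    have : ((((edgeWeight n (m + 1))⁻¹ : ℝ) : ℂ) * star (((edgeWeight n (m + 1))⁻¹ : ℝ) : ℂ) *
        star (((edgeWeight n (m + 1)) ^ 2 : ℝ) : ℂ)) = 1 := by
      simp only [Complex.star_def, Complex.conj_ofReal]
      push_cast; field_simp
    rw [this, one_smul]

/-- If `D` has trace `1/n`, then the ladder starting at the loop projection exhausts the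
whole algebra: its `n` rungs are orthogonal projections of equal trace, which is at least `1/n`. -/
theorem PathRelations.sum_ladder (hn : 1 ≤ n) {τ : R →ₗ[ℂ] ℂ} (h : PathRelations n C D G)
    (hτ : IsCentralizedBy τ C D G) (hX : C * X = X * C) (hCX : C * X * C = C)
    (hD : (τ D).re = 1 / n) :
    ∑ m : Fin n, ladder n D G (loopProjection C D X) m *
      star (ladder n D G (loopProjection C D X) m) = 1 := by
  have hQ := h.isLoopProjection hX hCX
  have hle := h.trace_le_loopProjection hτ hX hCX
  generalize loopProjection C D X = Q at *
  set Z := ∑ m : Fin n, ladder n D G Q m * star (ladder n D G Q m) with hZ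
  have hlQ : ∀ m, ladder n D G Q m * Q = ladder n D G Q m := by
    intro m
    induction m with
    | zero => exact hQ.mul_self
    | succ m ih => rw [ladder, smul_mul_assoc, mul_assoc, ih]
  have hsZ : star Z = Z := by simp [hZ, star_sum]
  have hZZ : Z * Z = Z := by
    rw [hZ, Finset.sum_mul]
    refine Finset.sum_congr rfl fun j _ => ?_
    rw [Finset.mul_sum, Finset.sum_eq_single j]
    · rw [mul_assoc, ← mul_assoc (star _), h.star_ladder_mul_self hn hQ j.2, ← mul_assoc, hlQ]
    · intro k _ hk
      rw [mul_assoc, ← mul_assoc (star _),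
        h.star_ladder_mul_ladder hn hQ (fun e => hk (Fin.ext e.symm))]
      simp
    · simp
  have hτZ : τ Z = n * τ Q := by
    rw [hZ, map_sum, Finset.sum_congr rfl fun m _ => h.trace_ladder hn hτ hQ m.2]
    simp
  have : 1 - Z = 0 := by
    apply hτ.faithful
    rw [star_sub, star_one, hsZ, mul_sub, mul_one, sub_mul, one_mul, hZZ, sub_self, sub_zero,
      map_sub, hτ.map_one, hτZ]
    have hn' : (0 : ℝ) < n := by positivity
    have : 1 ≤ n * (τ Q).re := by
      rw [hD, div_le_iff₀ hn'] at hle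
      linarith
    simp; exact this
  exact (sub_eq_zero.1 this).symm

end trace

/-! ### Operators mirrored by a bipartite vector -/

section generalizedInverse

variable {V : Type*} [NormedAddCommGroup V] [InnerProductSpace ℂ V] [FiniteDimensional ℂ V]

lemma LinearMap.inner_star_mul_self_apply (x : V →ₗ[ℂ] V) (v : V) :
    inner ℂ v ((star x * x) v) = (‖x v‖ : ℂ) ^ 2 := by
  rw [LinearMap.star_eq_adjoint, Module.End.mul_apply, LinearMap.adjoint_inner_right,
    inner_self_eq_norm_sq_to_K]
  rfl

lemma LinearMap.eq_zero_of_star_mul_self_eq_zero (x : V →ₗ[ℂ] V) (h : star x * x = 0) : x = 0 := by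
  ext v
  have := x.inner_star_mul_self_apply v
  rw [h] at this
  simpa using this.symm

lemma LinearMap.mul_eq_zero_of_pow_mul_eq_zero {C y : V →ₗ[ℂ] V} (hC : star C = C) {k : ℕ}
    (h : C ^ k * y = 0) : C * y = 0 := by
  induction k with
  | zero => rw [pow_zero, one_mul] at h; rw [h, mul_zero]
  | succ k ih =>
    rcases k with _ | k
    · simpa using h
    · refine ih (LinearMap.eq_zero_of_star_mul_self_eq_zero _ ?_)
      rw [star_mul, star_pow, hC, mul_assoc, ← mul_assoc (C ^ (k + 1)), ← pow_add,
        show k + 1 + (k + 1) = k + (k + 1 + 1) by ring, pow_add, mul_assoc (C ^ k), h]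
      simp

/-- A self-adjoint operator has a generalised inverse that is a polynomial in it: the root `0` of
its minimal polynomial is at most simple. -/
lemma LinearMap.exists_aeval_generalizedInverse {C : V →ₗ[ℂ] V} (hC : star C = C) :
    ∃ q : Polynomial ℂ, C * Polynomial.aeval C q * C = C := by
  have hp : minpoly ℂ C ≠ 0 := minpoly.ne_zero (Algebra.IsIntegral.isIntegral C)
  obtain ⟨g, hg, hdvd⟩ := Polynomial.exists_eq_pow_rootMultiplicity_mul_and_not_dvd _ hp 0
  rw [Polynomial.C_0, sub_zero] at hg hdvd
  have h0 : C * Polynomial.aeval C g = 0 := by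
    have := minpoly.aeval ℂ C
    rw [hg, map_mul, map_pow, Polynomial.aeval_X] at this
    exact LinearMap.mul_eq_zero_of_pow_mul_eq_zero hC this
  have hc : g.coeff 0 ≠ 0 := fun h => hdvd (Polynomial.X_dvd_iff.2 h)
  have hdecomp : Polynomial.aeval C g =
      Polynomial.aeval C g.divX * C + algebraMap ℂ _ (g.coeff 0) := by
    conv_lhs => rw [← Polynomial.divX_mul_X_add g]
    simp
  refine ⟨Polynomial.C (-(g.coeff 0)⁻¹) * g.divX, ?_⟩
  rw [hdecomp, mul_add, ← mul_assoc, Algebra.algebraMap_eq_smul_one, mul_smul_comm, mul_one] at h0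
  rw [map_mul, Polynomial.aeval_C, Algebra.algebraMap_eq_smul_one, smul_mul_assoc, one_mul,
    mul_smul_comm, smul_mul_assoc, eq_neg_of_add_eq_zero_left h0, smul_neg, smul_smul,
    neg_mul, inv_mul_cancel₀ hc]
  simp

end generalizedInverse

section mirror

section modules

variable {V W : Type*} [AddCommGroup V] [Module ℂ V] [AddCommGroup W] [Module ℂ W]

lemma LinearMap.rTensor_lTensor_comm (X : V →ₗ[ℂ] V) (Y : W →ₗ[ℂ] W) (ψ : V ⊗[ℂ] W) :
    X.rTensor W (Y.lTensor V ψ) = Y.lTensor V (X.rTensor W ψ) := by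
  rw [← LinearMap.comp_apply, ← LinearMap.comp_apply, LinearMap.rTensor_comp_lTensor,
    LinearMap.lTensor_comp_rTensor]

lemma LinearMap.rTensor_mul_eq (X X' : V →ₗ[ℂ] V) (ψ : V ⊗[ℂ] W) :
    (X * X').rTensor W ψ = X.rTensor W (X'.rTensor W ψ) := by
  rw [LinearMap.rTensor_mul]; rfl

lemma LinearMap.lTensor_mul_eq (Y Y' : W →ₗ[ℂ] W) (ψ : V ⊗[ℂ] W) :
    (Y * Y').lTensor V ψ = Y.lTensor V (Y'.lTensor V ψ) := by
  rw [LinearMap.lTensor_mul]; rfl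

end modules

section vectorState

variable {V W : Type*} [NormedAddCommGroup V] [InnerProductSpace ℂ V]
  [NormedAddCommGroup W] [InnerProductSpace ℂ W]

/-- The vector state of `ψ` on the operators of the first factor. -/
noncomputable def vectorState (ψ : V ⊗[ℂ] W) : (V →ₗ[ℂ] V) →ₗ[ℂ] ℂ where
  toFun X := inner ℂ ψ (X.rTensor W ψ)
  map_add' X Y := by rw [LinearMap.rTensor_add, LinearMap.add_apply, inner_add_right]
  map_smul' c X := by
    rw [LinearMap.rTensor_smul, LinearMap.smul_apply, inner_smul_right]; rfl

lemma vectorState_apply (ψ : V ⊗[ℂ] W) (X : V →ₗ[ℂ] V) :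
    vectorState ψ X = inner ℂ ψ (X.rTensor W ψ) := rfl

end vectorState

variable {V W : Type*} [NormedAddCommGroup V] [InnerProductSpace ℂ V] [FiniteDimensional ℂ V]
  [NormedAddCommGroup W] [InnerProductSpace ℂ W] [FiniteDimensional ℂ W]

/-- `X ⊗ 1` and `1 ⊗ Y` act in the same way on the vector `ψ`, and so do their adjoints. -/
structure Mirror (ψ : V ⊗[ℂ] W) (X : V →ₗ[ℂ] V) (Y : W →ₗ[ℂ] W) : Prop where
  eq : X.rTensor W ψ = Y.lTensor V ψ
  star_eq : (star X).rTensor W ψ = (star Y).lTensor V ψ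

namespace Mirror

variable {ψ : V ⊗[ℂ] W} {X X' : V →ₗ[ℂ] V} {Y Y' : W →ₗ[ℂ] W}

lemma of_star_eq (hX : star X = X) (hY : star Y = Y) (h : X.rTensor W ψ = Y.lTensor V ψ) :
    Mirror ψ X Y := ⟨h, by rw [hX, hY, h]⟩

protected lemma one : Mirror ψ (1 : V →ₗ[ℂ] V) (1 : W →ₗ[ℂ] W) := by
  refine of_star_eq (star_one _) (star_one _) ?_
  simp [Module.End.one_eq_id]

protected lemma star (h : Mirror ψ X Y) : Mirror ψ (star X) (star Y) :=
  ⟨h.star_eq, by rw [star_star, star_star, h.eq]⟩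

protected lemma add (h : Mirror ψ X Y) (h' : Mirror ψ X' Y') : Mirror ψ (X + X') (Y + Y') := by
  constructor
  · simp [LinearMap.rTensor_add, LinearMap.lTensor_add, h.eq, h'.eq]
  · simp [LinearMap.rTensor_add, LinearMap.lTensor_add, h.star_eq, h'.star_eq]

protected lemma smul (h : Mirror ψ X Y) (c : ℂ) : Mirror ψ (c • X) (c • Y) := by
  constructor
  · simp [LinearMap.rTensor_smul, LinearMap.lTensor_smul, h.eq]
  · simp [LinearMap.rTensor_smul, LinearMap.lTensor_smul, h.star_eq]

protected lemma sub (h : Mirror ψ X Y) (h' : Mirror ψ X' Y') : Mirror ψ (X - X') (Y - Y') := by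
  have := h.add (h'.smul (-1))
  simpa [sub_eq_add_neg] using this

protected lemma mul (h : Mirror ψ X Y) (h' : Mirror ψ X' Y') : Mirror ψ (X * X') (Y' * Y) := by
  constructor
  · rw [LinearMap.rTensor_mul_eq, h'.eq, LinearMap.rTensor_lTensor_comm, h.eq,
      LinearMap.lTensor_mul_eq]
  · rw [star_mul, star_mul, LinearMap.rTensor_mul_eq, h.star_eq,
      LinearMap.rTensor_lTensor_comm, h'.star_eq, LinearMap.lTensor_mul_eq]

protected lemma sum {ι : Type*} {s : Finset ι} {X : ι → V →ₗ[ℂ] V} {Y : ι → W →ₗ[ℂ] W}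
    (h : ∀ i ∈ s, Mirror ψ (X i) (Y i)) : Mirror ψ (∑ i ∈ s, X i) (∑ i ∈ s, Y i) := by
  classical
  induction s using Finset.induction_on with
  | empty => simpa using (Mirror.one (ψ := ψ)).smul 0
  | insert a s ha ih =>
    rw [Finset.sum_insert ha, Finset.sum_insert ha]
    exact (h a (by simp)).add (ih fun i hi => h i (by simp [hi]))

protected lemma aeval (h : Mirror ψ X Y) (q : Polynomial ℂ) :
    Mirror ψ (Polynomial.aeval X q) (Polynomial.aeval Y q) := by
  induction q using Polynomial.induction_on' with
  | add p q hp hq => simpa using hp.add hq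
  | monomial k a =>
    rw [Polynomial.aeval_monomial, Polynomial.aeval_monomial, ← Algebra.smul_def,
      ← Algebra.smul_def]
    refine Mirror.smul ?_ a
    induction k with
    | zero => simpa using Mirror.one
    | succ k ih =>
      rw [pow_succ X, pow_succ' Y]
      exact ih.mul h

lemma eq_right (hψ : ∀ Z : W →ₗ[ℂ] W, Z.lTensor V ψ = 0 → Z = 0) (h : Mirror ψ X Y)
    (h' : Mirror ψ X Y') : Y = Y' := by
  rw [← sub_eq_zero]
  apply hψ
  rw [LinearMap.lTensor_sub, LinearMap.sub_apply, ← h.eq, ← h'.eq, sub_self]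

protected lemma ladder {n : ℕ} {D G Q : V →ₗ[ℂ] V} {D' G' Q' : W →ₗ[ℂ] W} (hD : Mirror ψ D D')
    (hG : Mirror ψ G G') (hQ : Mirror ψ Q Q') (m : ℕ)
    (sD : star D' = D') (sG : star G' = G') (sQ : star Q' = Q') :
    Mirror ψ (ladder n D G Q m) (star (ladder n D' G' Q' m)) := by
  induction m with
  | zero => simpa only [ladder, sQ] using hQ
  | succ m ih =>
    have he : Mirror ψ (edgeOp D G (m + 1)) (star (edgeOp D' G' (m + 1))) := by
      unfold edgeOp
      split_ifs
      · rwa [sD]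
      · rwa [sG]
    rw [ladder, ladder, star_smul, star_mul, Complex.star_def, Complex.conj_ofReal]
    exact (he.mul ih).smul _

end Mirror

lemma vectorState_star_mul_self (ψ : V ⊗[ℂ] W) (X : V →ₗ[ℂ] V) :
    vectorState ψ (star X * X) = (‖X.rTensor W ψ‖ : ℂ) ^ 2 := by
  rw [vectorState_apply, LinearMap.rTensor_mul_eq, LinearMap.star_eq_adjoint,
    ← LinearMap.adjoint_rTensor, LinearMap.adjoint_inner_right, inner_self_eq_norm_sq_to_K]
  rfl

/-- A mirrored operator lies in the centralizer of the vector state. -/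
lemma Mirror.vectorState_mul_comm {ψ : V ⊗[ℂ] W} {X : V →ₗ[ℂ] V} {Y : W →ₗ[ℂ] W}
    (h : Mirror ψ X Y) (Z : V →ₗ[ℂ] V) : vectorState ψ (X * Z) = vectorState ψ (Z * X) := by
  calc inner ℂ ψ ((X * Z).rTensor W ψ)
      = inner ℂ ((star X).rTensor W ψ) (Z.rTensor W ψ) := by
        rw [LinearMap.rTensor_mul_eq, LinearMap.star_eq_adjoint, ← LinearMap.adjoint_rTensor,
          LinearMap.adjoint_inner_left]
    _ = inner ℂ ψ (Y.lTensor V (Z.rTensor W ψ)) := by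
        rw [h.star_eq, LinearMap.star_eq_adjoint, ← LinearMap.adjoint_lTensor,
          LinearMap.adjoint_inner_left]
    _ = inner ℂ ψ ((Z * X).rTensor W ψ) := by
        rw [← LinearMap.rTensor_lTensor_comm, ← h.eq, LinearMap.rTensor_mul_eq]

lemma isCentralizedBy_vectorState {ψ : V ⊗[ℂ] W} {C D G : V →ₗ[ℂ] V} {C' D' G' : W →ₗ[ℂ] W}
    (hψ : ‖ψ‖ = 1) (hψV : ∀ Z : V →ₗ[ℂ] V, Z.rTensor W ψ = 0 → Z = 0)
    (hC : Mirror ψ C C') (hD : Mirror ψ D D') (hG : Mirror ψ G G') :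
    IsCentralizedBy (vectorState ψ) C D G where
  map_one := by
    rw [vectorState_apply, Module.End.one_eq_id, LinearMap.rTensor_id, LinearMap.id_apply]
    exact (inner_self_eq_norm_sq_to_K (𝕜 := ℂ) ψ).trans (by simp [hψ])
  nonneg x := by
    rw [vectorState_star_mul_self]; norm_cast; positivity
  faithful x hx := by
    rw [vectorState_star_mul_self] at hx
    norm_cast at hx
    apply hψV
    rw [← norm_eq_zero]
    exact pow_eq_zero_iff (two_ne_zero) |>.1 (le_antisymm hx (by positivity))
  comm_C := hC.vectorState_mul_comm
  comm_D := hD.vectorState_mul_comm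
  comm_G := hG.vectorState_mul_comm

end mirror

/-! ### The four projections on `ℂⁿ` -/

/-- The weighted adjacency matrix of the matching of the path on `n` sites that pairs the site `m`
with the other end `2 e m - 1 - m` of the edge `e m`; the truncated subtraction makes `0` its own
partner along the loop `0`. -/
noncomputable def pathMatrix (n : ℕ) (e : ℕ → ℕ) : Matrix (Fin n) (Fin n) ℂ :=
  Matrix.of fun i j => if (i : ℕ) = 2 * e j - 1 - j then (edgeWeight n (e j) : ℂ) else 0

/-- The diagonal matrix with the entries `siteValue n m`. -/
noncomputable def siteMatrix (n : ℕ) : Matrix (Fin n) (Fin n) ℂ :=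
  Matrix.diagonal fun i => (siteValue n i : ℂ)

/-- Four elements of an algebra recovered from `C = P₁ + P₂ - 1`, `D = P₁ - P₂`, `G = P₃ - P₄`
when `P₁ + P₂ + P₃ + P₄ = 2 - 1/n`. -/
noncomputable def pathProjections {R : Type*} [Ring R] [Algebra ℂ R] (n : ℕ) (C D G : R) :
    Fin 4 → R :=
  ![(1 / 2 : ℂ) • (1 + C + D), (1 / 2 : ℂ) • (1 + C - D),
    (1 / 2 : ℂ) • ((1 - 1 / n : ℂ) • 1 - C + G), (1 / 2 : ℂ) • ((1 - 1 / n : ℂ) • 1 - C - G)]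

/-- The four projections on `ℂⁿ` with sum `2 - 1/n` that the self-tested strategies use. -/
noncomputable def idealProjection (n : ℕ) : Fin 4 → Matrix (Fin n) (Fin n) ℂ :=
  pathProjections n (siteMatrix n) (pathMatrix n evenEdge) (pathMatrix n oddEdge)

section pathAlgebra

variable {R : Type*} [Ring R]

lemma IsIdempotentElem.add_sub_one_anticomm {p q : R} (hp : p * p = p) (hq : q * q = q) :
    (p + q - 1) * (p - q) = -((p - q) * (p + q - 1)) := by
  simp only [mul_sub, sub_mul, mul_add, add_mul, hp, hq, mul_one, one_mul]; abel

lemma IsIdempotentElem.add_sub_one_sq_add {p q : R} (hp : p * p = p) (hq : q * q = q) :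
    (p + q - 1) * (p + q - 1) + (p - q) * (p - q) = 1 := by
  simp only [mul_sub, sub_mul, mul_add, add_mul, hp, hq, mul_one, one_mul]; abel

variable [Algebra ℂ R] {n : ℕ}

lemma half_smul_mul_self {a b : R} (hanti : a * b = -(b * a)) (hsq : a * a + b * b = 1) :
    ((1 / 2 : ℂ) • (1 + a + b)) * ((1 / 2 : ℂ) • (1 + a + b)) = (1 / 2 : ℂ) • (1 + a + b) := by
  have h : (1 + a + b) * (1 + a + b) = (2 : ℂ) • (1 + a + b) := by
    simp only [mul_add, add_mul, mul_one, one_mul, hanti, two_smul]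
    rw [← hsq]; abel
  rw [smul_mul_smul_comm, h, smul_smul]
  congr 1; norm_num

lemma pathProjections_eq {E : Fin 4 → R} (hsum : ∑ i, E i = (2 - 1 / n : ℂ) • 1) :
    pathProjections n (E 0 + E 1 - 1) (E 0 - E 1) (E 2 - E 3) = E := by
  rw [Fin.sum_univ_four] at hsum
  have h23 : (1 - 1 / n : ℂ) • (1 : R) - (E 0 + E 1 - 1) = E 2 + E 3 := by
    have : (1 - 1 / n : ℂ) • (1 : R) = (2 - 1 / n : ℂ) • 1 - 1 := by
      module
    rw [this, ← hsum]; abel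
  have half : ∀ x : R, (1 / 2 : ℂ) • (x + x) = x := fun x => by
    rw [← two_smul ℂ x, smul_smul]; norm_num
  funext i
  fin_cases i
  · change (1 / 2 : ℂ) • (1 + (E 0 + E 1 - 1) + (E 0 - E 1)) = E 0
    rw [← half (E 0)]; congr 1; rw [half]; abel
  · change (1 / 2 : ℂ) • (1 + (E 0 + E 1 - 1) - (E 0 - E 1)) = E 1
    rw [← half (E 1)]; congr 1; rw [half]; abel
  · change (1 / 2 : ℂ) • ((1 - 1 / n : ℂ) • 1 - (E 0 + E 1 - 1) + (E 2 - E 3)) = E 2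
    rw [h23, ← half (E 2)]; congr 1; rw [half]; abel
  · change (1 / 2 : ℂ) • ((1 - 1 / n : ℂ) • 1 - (E 0 + E 1 - 1) - (E 2 - E 3)) = E 3
    rw [h23, ← half (E 3)]; congr 1; rw [half]; abel

lemma sum_pathProjections (C D G : R) :
    ∑ i, pathProjections n C D G i = (2 - 1 / n : ℂ) • 1 := by
  simp only [pathProjections, Fin.sum_univ_four, Matrix.cons_val]
  module

variable [StarRing R]

/-- Four projections with sum `2 - 1/n` satisfy the path relations. -/
lemma pathRelations_of_projections {E : Fin 4 → R} (hstar : ∀ i, star (E i) = E i)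
    (hidem : ∀ i, E i * E i = E i) (hsum : ∑ i, E i = (2 - 1 / n : ℂ) • 1) :
    PathRelations n (E 0 + E 1 - 1) (E 0 - E 1) (E 2 - E 3) := by
  rw [Fin.sum_univ_four] at hsum
  have hshift : E 0 + E 1 - 1 + ((1 / n : ℝ) : ℂ) • (1 : R) = -(E 2 + E 3 - 1) := by
    have : E 0 + E 1 = (2 - 1 / n : ℂ) • 1 - (E 2 + E 3) := by rw [← hsum]; abel
    rw [this]; push_cast; module
  refine ⟨by simp [hstar], by simp [hstar], by simp [hstar],
    IsIdempotentElem.add_sub_one_anticomm (hidem 0) (hidem 1),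
    IsIdempotentElem.add_sub_one_sq_add (hidem 0) (hidem 1), ?_, ?_⟩
  · have h := IsIdempotentElem.add_sub_one_anticomm (hidem 2) (hidem 3)
    have h2 : E 0 + E 1 - 1 = -(E 2 + E 3 - 1) - ((1 / n : ℝ) : ℂ) • (1 : R) := by
      rw [← hshift]; abel
    generalize E 2 + E 3 - 1 = B at *
    generalize E 2 - E 3 = G at *
    rw [h2, sub_mul, mul_sub, neg_mul, h, smul_mul_assoc, mul_smul_comm, one_mul, mul_one,
      mul_neg]
    push_cast
    module
  · rw [hshift, neg_mul_neg]
    exact IsIdempotentElem.add_sub_one_sq_add (hidem 2) (hidem 3)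

/-- The path relations make the four elements `pathProjections` idempotent. -/
lemma PathRelations.pathProjections_mul_self {C D G : R} (h : PathRelations n C D G) (i : Fin 4) :
    pathProjections n C D G i * pathProjections n C D G i = pathProjections n C D G i := by
  have hG : -(C + ((1 / n : ℝ) : ℂ) • 1) * G = -(G * -(C + ((1 / n : ℝ) : ℂ) • 1)) := by
    rw [neg_mul, mul_neg, add_mul, mul_add, h.anti_G, smul_mul_assoc, mul_smul_comm, one_mul,
      mul_one]
    push_cast; module
  have hGG : -(C + ((1 / n : ℝ) : ℂ) • 1) * -(C + ((1 / n : ℝ) : ℂ) • 1) + G * G = 1 := by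
    rw [neg_mul_neg, h.sq_G]
  have e : (1 - 1 / n : ℂ) • (1 : R) - C = 1 + -(C + ((1 / n : ℝ) : ℂ) • 1) := by
    push_cast; module
  fin_cases i
  · exact half_smul_mul_self h.anti_D h.sq_D
  · change ((1 / 2 : ℂ) • (1 + C - D)) * ((1 / 2 : ℂ) • (1 + C - D)) = (1 / 2 : ℂ) • (1 + C - D)
    rw [sub_eq_add_neg]
    exact half_smul_mul_self (by rw [mul_neg, h.anti_D, neg_mul]) (by rw [neg_mul_neg, h.sq_D])
  · change ((1 / 2 : ℂ) • ((1 - 1 / n : ℂ) • 1 - C + G)) *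
      ((1 / 2 : ℂ) • ((1 - 1 / n : ℂ) • 1 - C + G)) = (1 / 2 : ℂ) • ((1 - 1 / n : ℂ) • 1 - C + G)
    rw [e]
    exact half_smul_mul_self hG hGG
  · change ((1 / 2 : ℂ) • ((1 - 1 / n : ℂ) • 1 - C - G)) *
      ((1 / 2 : ℂ) • ((1 - 1 / n : ℂ) • 1 - C - G)) = (1 / 2 : ℂ) • ((1 - 1 / n : ℂ) • 1 - C - G)
    rw [e, sub_eq_add_neg]
    exact half_smul_mul_self (by rw [mul_neg, hG, neg_mul]) (by rw [neg_mul_neg G, hGG])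

end pathAlgebra

section pathMatrix

variable {n : ℕ}

lemma sum_pathMatrix_smul {M : Type*} [AddCommGroup M] [Module ℂ M] {x : ℕ → M}
    (hx : ∀ k, n ≤ k → x k = 0) (e : ℕ → ℕ) (j : Fin n) :
    ∑ i : Fin n, pathMatrix n e i j • x i =
      (edgeWeight n (e j) : ℂ) • x (2 * e j - 1 - j) := by
  by_cases h : 2 * e j - 1 - j < n
  · rw [Finset.sum_eq_single ⟨2 * e j - 1 - j, h⟩]
    · simp [pathMatrix]
    · intro i _ hi
      have : (i : ℕ) ≠ 2 * e j - 1 - j := fun h' => hi (Fin.ext h')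
      simp [pathMatrix, this]
    · simp
  · rw [hx _ (by omega), smul_zero]
    refine Finset.sum_eq_zero fun i _ => ?_
    have : (i : ℕ) ≠ 2 * e j - 1 - j := by omega
    simp [pathMatrix, this]

lemma evenEdge_partner (m : ℕ) : evenEdge (2 * evenEdge m - 1 - m) = evenEdge m := by
  unfold evenEdge; omega

lemma oddEdge_partner (m : ℕ) : oddEdge (2 * oddEdge m - 1 - m) = oddEdge m := by
  unfold oddEdge; omega

lemma evenEdge_partner_partner (m : ℕ) :
    2 * evenEdge m - 1 - (2 * evenEdge m - 1 - m) = m := by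
  unfold evenEdge; omega

lemma oddEdge_partner_partner (m : ℕ) :
    2 * oddEdge m - 1 - (2 * oddEdge m - 1 - m) = m := by
  unfold oddEdge; omega

lemma star_pathMatrix {e : ℕ → ℕ} (he : ∀ m, e (2 * e m - 1 - m) = e m)
    (he' : ∀ m, 2 * e m - 1 - (2 * e m - 1 - m) = m) :
    star (pathMatrix n e) = pathMatrix n e := by
  ext i j
  rw [Matrix.star_apply]
  simp only [pathMatrix, Matrix.of_apply]
  by_cases h : (i : ℕ) = 2 * e j - 1 - j
  · have h2 : (j : ℕ) = 2 * e i - 1 - i := by rw [h, he, he']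
    have h3 : e i = e j := by rw [h, he]
    rw [if_pos h2, if_pos h, h3, Complex.star_def, Complex.conj_ofReal]
  · have h2 : ¬ (j : ℕ) = 2 * e i - 1 - i := fun h2 => h (by rw [h2, he, he'])
    rw [if_neg h, if_neg h2, star_zero]

/-- The square of a path matrix is diagonal. The edge that leaves the sites `0, …, n - 1` has the
label `n` and thus the weight `0`. -/
lemma pathMatrix_mul_self (hn : 1 ≤ n) {e : ℕ → ℕ} (he : ∀ m, e (2 * e m - 1 - m) = e m)
    (he' : ∀ m, 2 * e m - 1 - (2 * e m - 1 - m) = m)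
    (hle : ∀ m, e m ≤ m + 1) (hge : ∀ m, m ≤ e m) :
    pathMatrix n e * pathMatrix n e =
      Matrix.diagonal fun i : Fin n => ((1 - (e i / n : ℝ) ^ 2 : ℝ) : ℂ) := by
  ext i j
  have hj := edgeWeight_sq hn ((hle j).trans j.2)
  have key := sum_pathMatrix_smul (M := ℂ) (n := n)
    (x := fun k => if (i : ℕ) = 2 * e k - 1 - k ∧ k < n then (edgeWeight n (e k) : ℂ) else 0)
    (by intro k hk; simp; omega) e j
  rw [Matrix.mul_apply, Matrix.diagonal_apply]
  trans ∑ k : Fin n, pathMatrix n e k j • (if (i : ℕ) = 2 * e k - 1 - k ∧ (k : ℕ) < n then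
    (edgeWeight n (e k) : ℂ) else 0)
  · refine Finset.sum_congr rfl fun k _ => ?_
    simp [pathMatrix, mul_comm]
  rw [key, he, he']
  by_cases hij : i = j
  · subst hij
    rw [if_pos rfl, ← hj]
    by_cases hlt : 2 * e i - 1 - i < n
    · simp [hlt, sq]
    · have : e i = n := by have := hle i; have := hge i; have := i.2; omega
      simp [this, edgeWeight_self hn]
  · have : (i : ℕ) ≠ j := fun h => hij (Fin.ext h)
    simp [hij, this]

lemma siteValue_evenEdge_partner (m : ℕ) :
    siteValue n (2 * evenEdge m - 1 - m) = -siteValue n m := by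
  rcases Nat.even_or_odd m with h | h
  · rw [evenEdge_of_even h, siteValue_of_even h]
    rcases m with _ | m
    · simp [siteValue_of_even]
    · rw [show 2 * (m + 1) - 1 - (m + 1) = m by omega, siteValue_of_odd (by grind)]
      push_cast; rfl
  · rw [evenEdge_of_odd h, siteValue_of_odd h, show 2 * (m + 1) - 1 - m = m + 1 by omega,
      siteValue_of_even (by grind)]
    push_cast; ring

lemma siteValue_oddEdge_partner (m : ℕ) :
    siteValue n (2 * oddEdge m - 1 - m) = -siteValue n m - 2 / n := by
  rcases Nat.even_or_odd m with h | h
  · rw [oddEdge_of_even h, siteValue_of_even h, show 2 * (m + 1) - 1 - m = m + 1 by omega,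
      siteValue_of_odd (by grind)]
    push_cast; ring
  · rw [oddEdge_of_odd h, siteValue_of_odd h]
    rcases m with _ | m
    · simp at h
    · rw [show 2 * (m + 1) - 1 - (m + 1) = m by omega, siteValue_of_even (by grind)]
      push_cast; ring

lemma siteValue_sq (m : ℕ) : siteValue n m ^ 2 = (evenEdge m / n : ℝ) ^ 2 := by
  rw [siteValue, mul_div_assoc, mul_pow, ← pow_mul, mul_comm m 2, pow_mul]; simp

lemma siteValue_add_sq (m : ℕ) : (siteValue n m + 1 / n) ^ 2 = (oddEdge m / n : ℝ) ^ 2 := by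
  rcases Nat.even_or_odd m with h | h
  · rw [siteValue_of_even h, oddEdge_of_even h]; push_cast; ring
  · rw [siteValue_of_odd h, oddEdge_of_odd h]; ring

lemma pathRelations_pathMatrix (hn : 1 ≤ n) :
    PathRelations n (siteMatrix n) (pathMatrix n evenEdge) (pathMatrix n oddEdge) where
  star_C := by
    ext i j
    rw [siteMatrix, Matrix.star_eq_conjTranspose, Matrix.diagonal_conjTranspose]
    congr 2; ext k; simp
  star_D := star_pathMatrix evenEdge_partner evenEdge_partner_partner
  star_G := star_pathMatrix oddEdge_partner oddEdge_partner_partner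
  anti_D := by
    ext i j
    rw [siteMatrix, Matrix.diagonal_mul, Matrix.neg_apply, Matrix.mul_diagonal]
    simp only [pathMatrix, Matrix.of_apply]
    split_ifs with h
    · rw [h, siteValue_evenEdge_partner]; push_cast; ring
    · simp
  sq_D := by
    rw [pathMatrix_mul_self hn evenEdge_partner evenEdge_partner_partner
      (by unfold evenEdge; omega) (by unfold evenEdge; omega), siteMatrix,
      Matrix.diagonal_mul_diagonal, Matrix.diagonal_add, ← Matrix.diagonal_one]
    congr 1; ext i
    rw [← siteValue_sq]; push_cast; ring
  anti_G := by
    ext i j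
    rw [siteMatrix, Matrix.diagonal_mul, Matrix.sub_apply, Matrix.neg_apply, Matrix.mul_diagonal,
      Matrix.smul_apply]
    simp only [pathMatrix, Matrix.of_apply]
    split_ifs with h
    · rw [h, siteValue_oddEdge_partner, smul_eq_mul]; push_cast; ring
    · simp
  sq_G := by
    have : siteMatrix n + ((1 / n : ℝ) : ℂ) • 1 =
        Matrix.diagonal fun i : Fin n => ((siteValue n i + 1 / n : ℝ) : ℂ) := by
      rw [siteMatrix, ← Matrix.diagonal_one, ← Matrix.diagonal_smul, Matrix.diagonal_add]
      congr 1; ext i; simp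
    rw [this, pathMatrix_mul_self hn oddEdge_partner oddEdge_partner_partner
      (by unfold oddEdge; omega) (by unfold oddEdge; omega),
      Matrix.diagonal_mul_diagonal, Matrix.diagonal_add, ← Matrix.diagonal_one]
    congr 1; ext i
    rw [← siteValue_add_sq]; push_cast; ring

lemma idealProjection_mul_self (hn : 1 ≤ n) (i : Fin 4) :
    idealProjection n i * idealProjection n i = idealProjection n i :=
  (pathRelations_pathMatrix hn).pathProjections_mul_self i

lemma sum_idealProjection : ∑ i, idealProjection n i = (2 - 1 / n : ℂ) • 1 :=
  sum_pathProjections _ _ _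

lemma star_idealProjection (hn : 1 ≤ n) (i : Fin 4) :
    star (idealProjection n i) = idealProjection n i := by
  have h := pathRelations_pathMatrix hn
  fin_cases i <;>
    simp [idealProjection, pathProjections, h.star_C, h.star_D, h.star_G]

lemma pathMatrix_transpose {e : ℕ → ℕ} (he : ∀ m, e (2 * e m - 1 - m) = e m)
    (he' : ∀ m, 2 * e m - 1 - (2 * e m - 1 - m) = m) :
    (pathMatrix n e).transpose = pathMatrix n e := by
  have h := star_pathMatrix (n := n) he he'
  ext i j
  have := congrFun (congrFun h i) j
  rw [Matrix.star_apply] at this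
  rw [Matrix.transpose_apply, ← this]
  simp only [pathMatrix, Matrix.of_apply]
  split_ifs <;> simp

lemma transpose_idealProjection (i : Fin 4) :
    (idealProjection n i).transpose = idealProjection n i := by
  have hC : (siteMatrix n).transpose = siteMatrix n := Matrix.diagonal_transpose _
  have hD := pathMatrix_transpose (n := n) evenEdge_partner evenEdge_partner_partner
  have hG := pathMatrix_transpose (n := n) oddEdge_partner oddEdge_partner_partner
  fin_cases i <;>
    simp [idealProjection, pathProjections, hC, hD, hG]

end pathMatrix

/-! ### Frames and the dilation of strategies of full support -/

section frame

variable {n : ℕ} {V W : Type*}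
  [NormedAddCommGroup V] [InnerProductSpace ℂ V] [FiniteDimensional ℂ V]
  [NormedAddCommGroup W] [InnerProductSpace ℂ W] [FiniteDimensional ℂ W]

/-- The map `v ↦ ∑ⱼ eⱼ ⊗ sⱼ* v` into `ℂⁿ ⊗ V`. -/
noncomputable def frameMap (s : Fin n → V →ₗ[ℂ] V) : V →ₗ[ℂ] EuclideanSpace ℂ (Fin n) ⊗[ℂ] V :=
  ∑ j, TensorProduct.mk ℂ _ V (EuclideanSpace.basisFun (Fin n) ℂ j) ∘ₗ star (s j)

lemma frameMap_apply (s : Fin n → V →ₗ[ℂ] V) (v : V) :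
    frameMap s v = ∑ j, EuclideanSpace.basisFun (Fin n) ℂ j ⊗ₜ[ℂ] (star (s j) v) := by
  simp [frameMap, LinearMap.sum_apply]

lemma norm_frameMap {s : Fin n → V →ₗ[ℂ] V} (hs : ∑ j, s j * star (s j) = 1) (v : V) :
    ‖frameMap s v‖ = ‖v‖ := by
  have h : inner ℂ (frameMap s v) (frameMap s v) = inner ℂ v v := by
    conv_rhs => enter [3]; rw [← Module.End.one_apply (R := ℂ) v, ← hs]
    rw [frameMap_apply, sum_inner, LinearMap.sum_apply, inner_sum]
    refine Finset.sum_congr rfl fun j _ => ?_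
    rw [inner_sum, Finset.sum_eq_single j]
    · rw [TensorProduct.inner_tmul, orthonormal_iff_ite.1
        (EuclideanSpace.basisFun (Fin n) ℂ).orthonormal, if_pos rfl, one_mul, Module.End.mul_apply,
        LinearMap.star_eq_adjoint, LinearMap.adjoint_inner_left]
    · intro k _ hk
      rw [TensorProduct.inner_tmul, orthonormal_iff_ite.1
        (EuclideanSpace.basisFun (Fin n) ℂ).orthonormal, if_neg hk.symm, zero_mul]
    · simp
  have h := (inner_self_eq_norm_sq_to_K (𝕜 := ℂ) (frameMap s v)).symm.trans
    (h.trans (inner_self_eq_norm_sq_to_K v))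
  norm_cast at h
  exact (pow_left_inj₀ (norm_nonneg _) (norm_nonneg _) two_ne_zero).1 h

lemma toEuclideanLin_basisFun (M : Matrix (Fin n) (Fin n) ℂ) (i : Fin n) :
    Matrix.toEuclideanLin M (EuclideanSpace.basisFun (Fin n) ℂ i) =
      ∑ j, M j i • EuclideanSpace.basisFun (Fin n) ℂ j := by
  ext k
  simp [Matrix.toLpLin_apply, Pi.single_apply]

lemma frameMap_apply_apply {s : Fin n → V →ₗ[ℂ] V} {X : V →ₗ[ℂ] V} {M : Matrix (Fin n) (Fin n) ℂ}
    (hX : star X = X) (hM : star M = M) (h : ∀ j, X * s j = ∑ i, M i j • s i) (v : V) :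
    frameMap s (X v) = (Matrix.toEuclideanLin M).rTensor V (frameMap s v) := by
  have h' : ∀ j, star (s j) (X v) = ∑ i, M j i • star (s i) v := by
    intro j
    have := congrArg star (h j)
    rw [star_mul, hX, star_sum] at this
    rw [← Module.End.mul_apply, this, LinearMap.sum_apply]
    refine Finset.sum_congr rfl fun i _ => ?_
    rw [star_smul, LinearMap.smul_apply]
    congr 1
    conv_rhs => rw [← hM, Matrix.star_apply]
  rw [frameMap_apply, frameMap_apply, map_sum]
  simp only [h', LinearMap.rTensor_tmul, toEuclideanLin_basisFun, TensorProduct.tmul_sum,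
    TensorProduct.sum_tmul, TensorProduct.tmul_smul, TensorProduct.smul_tmul']
  rw [Finset.sum_comm]

lemma map_frameMap_frameMap (ψ : V ⊗[ℂ] W) {s : Fin n → V →ₗ[ℂ] V} {s' : Fin n → W →ₗ[ℂ] W}
    {Q : V →ₗ[ℂ] V} (hmir : ∀ j, Mirror ψ (s j) (star (s' j)))
    (hsame : ∀ j, star (s j) * s j = Q) (hne : ∀ j k, j ≠ k → star (s j) * s k = 0) :
    TensorProduct.map (frameMap s) (frameMap s') ψ =
      TensorProduct.tensorTensorTensorComm ℂ _ _ V W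
        ((∑ j, EuclideanSpace.basisFun (Fin n) ℂ j ⊗ₜ[ℂ] EuclideanSpace.basisFun (Fin n) ℂ j) ⊗ₜ[ℂ]
          Q.rTensor W ψ) := by
  have hterm : ∀ (X : V →ₗ[ℂ] V) (Y : W →ₗ[ℂ] W) (a b : EuclideanSpace ℂ (Fin n)) (ξ : V ⊗[ℂ] W),
      TensorProduct.map (TensorProduct.mk ℂ _ V a ∘ₗ X) (TensorProduct.mk ℂ _ W b ∘ₗ Y) ξ =
        TensorProduct.tensorTensorTensorComm ℂ _ _ V W
          ((a ⊗ₜ[ℂ] b) ⊗ₜ[ℂ] X.rTensor W (Y.lTensor V ξ)) := by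
    intro X Y a b ξ
    induction ξ with
    | zero => simp
    | tmul x y => simp
    | add x y hx hy => simp only [map_add, hx, hy, TensorProduct.tmul_add]
  have hexpand : TensorProduct.map (frameMap s) (frameMap s') ψ = ∑ j, ∑ k,
      TensorProduct.map
        (TensorProduct.mk ℂ _ V (EuclideanSpace.basisFun (Fin n) ℂ j) ∘ₗ star (s j))
        (TensorProduct.mk ℂ _ W (EuclideanSpace.basisFun (Fin n) ℂ k) ∘ₗ star (s' k)) ψ := by
    simp only [frameMap, ← TensorProduct.mapBilinear_apply, map_sum, LinearMap.sum_apply]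
    rw [Finset.sum_comm]
  rw [hexpand, TensorProduct.sum_tmul, map_sum]
  refine Finset.sum_congr rfl fun j _ => ?_
  rw [Finset.sum_eq_single j]
  · rw [hterm, ← (hmir j).eq, ← LinearMap.rTensor_mul_eq, hsame]
  · intro k _ hk
    rw [hterm, ← (hmir k).eq, ← LinearMap.rTensor_mul_eq, hne j k hk.symm]
    simp
  · simp

lemma mul_pathProjections_ladder (hn : 1 ≤ n) {C D G Q : V →ₗ[ℂ] V} (h : PathRelations n C D G)
    (hQ : IsLoopProjection C D Q) (i : Fin 4) (j : Fin n) :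
    pathProjections n C D G i * ladder n D G Q j =
      ∑ k : Fin n, idealProjection n i k j • ladder n D G Q k := by
  have proper := LinearMap.eq_zero_of_star_mul_self_eq_zero (V := V)
  have hle : ∀ k, n ≤ k → ladder n D G Q k = 0 := fun k hk => ladder_of_le hn hk
  have h1 : (1 : V →ₗ[ℂ] V) * ladder n D G Q j =
      ∑ k : Fin n, (1 : Matrix (Fin n) (Fin n) ℂ) k j • ladder n D G Q k := by
    simp [Matrix.one_apply]
  have hC : C * ladder n D G Q j = ∑ k : Fin n, siteMatrix n k j • ladder n D G Q k := by
    rw [h.C_mul_ladder hQ]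
    simp [siteMatrix, Matrix.diagonal_apply]
  have hD : D * ladder n D G Q j = ∑ k : Fin n, pathMatrix n evenEdge k j • ladder n D G Q k := by
    rw [h.D_mul_ladder hn hQ proper j.2, sum_pathMatrix_smul hle]
  have hG : G * ladder n D G Q j = ∑ k : Fin n, pathMatrix n oddEdge k j • ladder n D G Q k := by
    rw [h.G_mul_ladder hn hQ proper j.2, sum_pathMatrix_smul hle]
  fin_cases i <;>
    simp only [idealProjection, pathProjections, Fin.zero_eta, Fin.mk_one, Fin.reduceFinMk,
      Matrix.cons_val, smul_mul_assoc, add_mul, sub_mul, h1, hC, hD, hG, Matrix.smul_apply,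
      Matrix.add_apply, Matrix.sub_apply, smul_eq_mul, mul_smul, add_smul, sub_smul,
      Finset.smul_sum, Finset.sum_add_distrib, Finset.sum_sub_distrib, smul_add, smul_sub]

/-- If the four projections `E i` of the first party have sum `2 - 1/n` and the vector `ψ`
mirrors them to `F i`, then `ψ` is, up to local isometries, a maximally entangled state on which
`E i` and `F i` act as the ideal projections. -/
theorem exists_isometry_of_fullSupport (hn : 1 ≤ n) {ψ : V ⊗[ℂ] W} (hψ : ‖ψ‖ = 1)
    (hV : ∀ Z : V →ₗ[ℂ] V, Z.rTensor W ψ = 0 → Z = 0)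
    (hW : ∀ Z : W →ₗ[ℂ] W, Z.lTensor V ψ = 0 → Z = 0)
    {E : Fin 4 → V →ₗ[ℂ] V} {F : Fin 4 → W →ₗ[ℂ] W}
    (hE : ∀ i, star (E i) = E i) (hF : ∀ i, star (F i) = F i)
    (hEF : ∀ i, (E i).rTensor W ψ = (F i).lTensor V ψ)
    (hidem : ∀ i, E i * E i = E i) (hsum : ∑ i, E i = (2 - 1 / n : ℂ) • 1)
    (hdiff : (vectorState ψ (E 0 - E 1)).re = 1 / n) :
    ∃ (T : V →ₗᵢ[ℂ] EuclideanSpace ℂ (Fin n) ⊗[ℂ] V)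
      (T' : W →ₗᵢ[ℂ] EuclideanSpace ℂ (Fin n) ⊗[ℂ] W) (aux : V ⊗[ℂ] W),
      ‖aux‖ = 1 ∧
      (∀ i v, T (E i v) = (Matrix.toEuclideanLin (idealProjection n i)).rTensor V (T v)) ∧
      (∀ i w, T' (F i w) = (Matrix.toEuclideanLin (idealProjection n i)).rTensor W (T' w)) ∧
      TensorProduct.map T.toLinearMap T'.toLinearMap ψ =
        TensorProduct.tensorTensorTensorComm ℂ _ _ V W
          (maxEntangledVec (EuclideanSpace.basisFun (Fin n) ℂ) ⊗ₜ[ℂ] aux) := by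
  have hmir : ∀ i, Mirror ψ (E i) (F i) := fun i => .of_star_eq (hE i) (hF i) (hEF i)
  have hidem' : ∀ i, F i * F i = F i := fun i => by
    have := (hmir i).mul (hmir i)
    rw [hidem] at this
    exact this.eq_right hW (hmir i)
  have hsum' : ∑ i, F i = (2 - 1 / n : ℂ) • 1 := by
    have := Mirror.sum (s := Finset.univ) fun i _ => hmir i
    rw [hsum] at this
    exact this.eq_right hW (Mirror.one.smul _)
  have h := pathRelations_of_projections hE hidem hsum
  have h' := pathRelations_of_projections hF hidem' hsum'
  have hEeq := pathProjections_eq hsum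
  have hFeq := pathProjections_eq hsum'
  have mC : Mirror ψ (E 0 + E 1 - 1) (F 0 + F 1 - 1) := ((hmir 0).add (hmir 1)).sub .one
  have mD : Mirror ψ (E 0 - E 1) (F 0 - F 1) := (hmir 0).sub (hmir 1)
  have mG : Mirror ψ (E 2 - E 3) (F 2 - F 3) := (hmir 2).sub (hmir 3)
  generalize E 0 + E 1 - 1 = C at *
  generalize E 0 - E 1 = D at *
  generalize E 2 - E 3 = G at *
  generalize F 0 + F 1 - 1 = C' at *
  generalize F 0 - F 1 = D' at *
  generalize F 2 - F 3 = G' at *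
  -- The same polynomial yields generalised inverses on both sides.
  obtain ⟨q, hq⟩ := LinearMap.exists_aeval_generalizedInverse h.star_C
  have hcomm : C * Polynomial.aeval C q = Polynomial.aeval C q * C := by
    simpa using congrArg (Polynomial.aeval C) (mul_comm Polynomial.X q)
  have hcomm' : C' * Polynomial.aeval C' q = Polynomial.aeval C' q * C' := by
    simpa using congrArg (Polynomial.aeval C') (mul_comm Polynomial.X q)
  have mX := mC.aeval q
  have hq' : C' * Polynomial.aeval C' q * C' = C' := by
    have := mC.mul (mX.mul mC)
    rw [← mul_assoc, hq] at this
    exact this.eq_right hW mC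
  generalize Polynomial.aeval C q = X at *
  generalize Polynomial.aeval C' q = X' at *
  have hQ := h.isLoopProjection hcomm hq
  have hQ' := h'.isLoopProjection hcomm' hq'
  have mK : Mirror ψ (1 - C * X) (1 - C' * X') := by
    rw [hcomm']; exact Mirror.one.sub (mC.mul mX)
  have mQ : Mirror ψ (loopProjection C D X) (loopProjection C' D' X') := by
    have := (mK.add (mD.mul mK)).smul ((1 / 2 : ℝ) : ℂ)
    rwa [← h'.D_mul_kernelProjection hcomm' hq'] at this
  have hτ := isCentralizedBy_vectorState hψ hV mC mD mG
  have hone := h.sum_ladder hn hτ hcomm hq hdiff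
  generalize loopProjection C D X = Q at *
  generalize loopProjection C' D' X' = Q' at *
  have ms : ∀ m, Mirror ψ (ladder n D G Q m) (star (ladder n D' G' Q' m)) := fun m =>
    mD.ladder mG mQ m h'.star_D h'.star_G hQ'.star_eq
  have hone' : ∑ m : Fin n, ladder n D' G' Q' m * star (ladder n D' G' Q' m) = 1 := by
    have := Mirror.sum (s := Finset.univ) fun (m : Fin n) _ => (ms m).mul (ms m).star
    rw [hone] at this
    simp only [star_star] at this
    exact this.eq_right hW .one
  refine ⟨⟨frameMap fun j : Fin n => ladder n D G Q j, norm_frameMap hone⟩,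
    ⟨frameMap fun j : Fin n => ladder n D' G' Q' j, norm_frameMap hone'⟩,
    (Real.sqrt n : ℂ) • Q.rTensor W ψ, ?_, fun i v => ?_, fun i w => ?_, ?_⟩
  · have h1 : (n : ℂ) * vectorState ψ Q = 1 := by
      rw [← hτ.map_one, ← hone, map_sum,
        Finset.sum_congr rfl fun m _ => h.trace_ladder hn hτ hQ m.2]
      simp
    have h2 := vectorState_star_mul_self ψ Q
    rw [hQ.star_eq, hQ.mul_self] at h2
    rw [h2] at h1
    have h3 : (n : ℝ) * ‖Q.rTensor W ψ‖ ^ 2 = 1 := by exact_mod_cast h1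
    rw [norm_smul, Complex.norm_real, Real.norm_of_nonneg (Real.sqrt_nonneg _),
      ← pow_left_inj₀ (by positivity) zero_le_one two_ne_zero, mul_pow, Real.sq_sqrt (by positivity),
      h3, one_pow]
  · refine frameMap_apply_apply (hE i) (star_idealProjection hn i) (fun j => ?_) v
    rw [← mul_pathProjections_ladder hn h hQ, hEeq]
  · refine frameMap_apply_apply (hF i) (star_idealProjection hn i) (fun j => ?_) w
    rw [← mul_pathProjections_ladder hn h' hQ', hFeq]
  · have hsq : (Real.sqrt n : ℂ) ≠ 0 := by
      have : (0 : ℝ) < n := by positivity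
      exact_mod_cast (Real.sqrt_pos.2 this).ne'
    have := map_frameMap_frameMap ψ (fun j : Fin n => ms j)
      (fun j => h.star_ladder_mul_self hn hQ j.2)
      (fun j k hjk => h.star_ladder_mul_ladder hn hQ (fun e => hjk (Fin.ext e)))
    rw [maxEntangledVec, TensorProduct.smul_tmul_smul, inv_mul_cancel₀ hsq, one_smul]
    exact this

end frame

/-! ### Restriction to the local supports -/

/-- The two outcomes `X`, `1 - X` of a binary measurement. -/
def binaryOutcome {R : Type*} [Ring R] (X : R) : Fin 2 → R := ![X, 1 - X]

section support

variable {V W : Type} [AddCommGroup V] [Module ℂ V] [AddCommGroup W] [Module ℂ W]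

/-- The smallest subspace `U` with `ψ ∈ U ⊗ W` is spanned by the coefficients of `ψ` with respect to a
basis of `W`. -/
lemma exists_left_support [FiniteDimensional ℂ W] (ψ : V ⊗[ℂ] W) :
    ∃ (U : Submodule ℂ V) (ξ : U ⊗[ℂ] W), U.subtype.rTensor W ξ = ψ ∧
      ∀ (M : Type) [AddCommGroup M] [Module ℂ M] (X : U →ₗ[ℂ] M), X.rTensor W ξ = 0 → X = 0 := by
  let b := Module.finBasis ℂ W
  let x := TensorProduct.equivFinsuppOfBasisRight (M := V) b ψ
  have hx : ψ = ∑ i, x i ⊗ₜ[ℂ] b i := by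
    rw [← (TensorProduct.equivFinsuppOfBasisRight (M := V) b).symm_apply_apply ψ,
      TensorProduct.equivFinsuppOfBasisRight_symm_apply, Finsupp.sum_fintype _ _ (by simp)]
  let U := Submodule.span ℂ (Set.range x)
  let y : Fin (Module.finrank ℂ W) → U := fun i => ⟨x i, Submodule.subset_span ⟨i, rfl⟩⟩
  refine ⟨U, ∑ i, y i ⊗ₜ[ℂ] b i, ?_, ?_⟩
  · rw [hx, map_sum]; rfl
  · intro M _ _ X hX
    have h0 : ∀ i, X (y i) = 0 := by
      intro i
      have h1 : TensorProduct.equivFinsuppOfBasisRight (M := M) b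
          (∑ i, X (y i) ⊗ₜ[ℂ] b i) i = 0 := by
        rw [map_sum] at hX
        simp only [LinearMap.rTensor_tmul] at hX
        rw [hX]; simp
      rw [map_sum] at h1
      simpa [TensorProduct.equivFinsuppOfBasisRight_apply_tmul_apply, Finsupp.finsetSum_apply,
        Finsupp.single_apply] using h1
    have hle : U ≤ (LinearMap.ker X).map U.subtype := by
      rw [Submodule.span_le]
      rintro _ ⟨i, rfl⟩
      exact ⟨y i, h0 i, rfl⟩
    ext u
    obtain ⟨u', hu', h⟩ := hle u.2
    have : u' = u := Subtype.ext h
    subst this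
    simpa using hu'

/-- Every bipartite vector is supported on a pair of local subspaces on which operators of
either party are determined by their action on the vector. -/
lemma exists_support [FiniteDimensional ℂ V] [FiniteDimensional ℂ W] (ψ : V ⊗[ℂ] W) :
    ∃ (A : Submodule ℂ V) (B : Submodule ℂ W) (ξ : A ⊗[ℂ] B),
      TensorProduct.map A.subtype B.subtype ξ = ψ ∧
      (∀ (M : Type) [AddCommGroup M] [Module ℂ M] (X : A →ₗ[ℂ] M),
        TensorProduct.map X B.subtype ξ = 0 → X = 0) ∧
      (∀ (M : Type) [AddCommGroup M] [Module ℂ M] (Y : B →ₗ[ℂ] M),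
        TensorProduct.map A.subtype Y ξ = 0 → Y = 0) := by
  obtain ⟨A, ξ₁, h1, hA⟩ := exists_left_support ψ
  obtain ⟨B, ξ₂, h2, hB⟩ := exists_left_support (TensorProduct.comm ℂ A W ξ₁)
  have hcomm : ∀ {M N : Type} [AddCommGroup M] [Module ℂ M] [AddCommGroup N] [Module ℂ N]
      (X : A →ₗ[ℂ] M) (Y : B →ₗ[ℂ] N), TensorProduct.comm ℂ M N (TensorProduct.map X Y
        ((TensorProduct.comm ℂ A B).symm ξ₂)) = TensorProduct.map Y X ξ₂ := by
    intro M N _ _ _ _ X Y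
    rw [← TensorProduct.map_comm, LinearEquiv.apply_symm_apply]
  have h3 : TensorProduct.map (LinearMap.id : A →ₗ[ℂ] A) B.subtype
      ((TensorProduct.comm ℂ A B).symm ξ₂) = ξ₁ := by
    apply (TensorProduct.comm ℂ A W).injective
    rw [← h2, hcomm]
    rfl
  refine ⟨A, B, (TensorProduct.comm ℂ A B).symm ξ₂, ?_, ?_, ?_⟩
  · rw [← h1, ← h3, ← LinearMap.comp_apply, LinearMap.rTensor_comp_map, LinearMap.comp_id]
  · intro M _ _ X hX
    apply hA M X
    rw [← h3, ← LinearMap.comp_apply, LinearMap.rTensor_comp_map, LinearMap.comp_id, hX]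
  · intro M _ _ Y hY
    apply hB M Y
    apply Module.Flat.lTensor_preserves_injective_linearMap (M := M) A.subtype A.injective_subtype
    rw [map_zero, ← LinearMap.comp_apply, LinearMap.lTensor_comp_rTensor, ← hcomm, hY, map_zero]

end support

section extension

variable {V H : Type*} [NormedAddCommGroup V] [InnerProductSpace ℂ V]
  [NormedAddCommGroup H] [InnerProductSpace ℂ H] [FiniteDimensional ℂ H]

/-- An isometry on a subspace extends to the whole space if the target is large enough, which is
expressed by the isometry `j`. -/
lemma LinearIsometry.exists_extension {U : Submodule ℂ V} (f : U →ₗᵢ[ℂ] H) (j : V →ₗᵢ[ℂ] H) :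
    ∃ g : V →ₗᵢ[ℂ] H, ∀ u : U, g u = f u := by
  let i := (j.comp U.subtypeₗᵢ).equivRange
  refine ⟨(f.comp i.symm.toLinearIsometry).extend.comp j, fun u => ?_⟩
  have h : j u = (i u : H) := rfl
  rw [LinearIsometry.coe_comp, Function.comp_apply, h, LinearIsometry.extend_apply]
  simp

end extension

lemma tensorTensorTensorComm_map {A A' B B' C C' D D' : Type*}
    [AddCommGroup A] [Module ℂ A] [AddCommGroup A'] [Module ℂ A']
    [AddCommGroup B] [Module ℂ B] [AddCommGroup B'] [Module ℂ B']
    [AddCommGroup C] [Module ℂ C] [AddCommGroup C'] [Module ℂ C']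
    [AddCommGroup D] [Module ℂ D] [AddCommGroup D'] [Module ℂ D']
    (f : A →ₗ[ℂ] A') (g : B →ₗ[ℂ] B') (h : C →ₗ[ℂ] C') (k : D →ₗ[ℂ] D')
    (x : A ⊗[ℂ] B) (y : C ⊗[ℂ] D) :
    TensorProduct.map (TensorProduct.map f h) (TensorProduct.map g k)
        (TensorProduct.tensorTensorTensorComm ℂ A B C D (x ⊗ₜ[ℂ] y)) =
      TensorProduct.tensorTensorTensorComm ℂ A' B' C' D'
        (TensorProduct.map f g x ⊗ₜ[ℂ] TensorProduct.map h k y) := by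
  exact LinearMap.congr_fun (TensorProduct.tensorTensorTensorComm_comp_map ℂ f g h k).symm (x ⊗ₜ[ℂ] y)

section selfTest

variable {n : ℕ} {V W : Type}
  [NormedAddCommGroup V] [InnerProductSpace ℂ V] [FiniteDimensional ℂ V]
  [NormedAddCommGroup W] [InnerProductSpace ℂ W] [FiniteDimensional ℂ W]

lemma star_restrict_eq {E : V →ₗ[ℂ] V} (hE : star E = E) {A : Submodule ℂ V}
    (hA : ∀ v ∈ A, E v ∈ A) : star (E.restrict hA) = E.restrict hA := by
  have h : E.IsSymmetric := (LinearMap.isSymmetric_iff_isSelfAdjoint E).2 hE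
  exact (LinearMap.isSymmetric_iff_isSelfAdjoint _).1 (h.restrict_invariant hA)

/-- An isometry on an invariant subspace that intertwines `E i` with the ideal projections extends
to the whole local space, and still intertwines both outcomes on the subspace. -/
lemma exists_extension_intertwining (hn : 1 ≤ n) {A : Submodule ℂ V} {E : Fin 4 → V →ₗ[ℂ] V}
    (hinv : ∀ i, ∀ v ∈ A, E i v ∈ A) (T : A →ₗᵢ[ℂ] EuclideanSpace ℂ (Fin n) ⊗[ℂ] A)
    (hT : ∀ i v, T ((E i).restrict (hinv i) v) =
      (Matrix.toEuclideanLin (idealProjection n i)).rTensor A (T v)) :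
    ∃ U : V →ₗᵢ[ℂ] EuclideanSpace ℂ (Fin n) ⊗[ℂ] V, ∀ i a,
      U.toLinearMap ∘ₗ binaryOutcome (E i) a ∘ₗ A.subtype =
        TensorProduct.map (Matrix.toEuclideanLin (binaryOutcome (idealProjection n i) a))
          A.subtype ∘ₗ T.toLinearMap := by
  let j : V →ₗᵢ[ℂ] EuclideanSpace ℂ (Fin n) ⊗[ℂ] V :=
    ⟨TensorProduct.mk ℂ _ V (EuclideanSpace.basisFun (Fin n) ℂ ⟨0, hn⟩), fun v => by simp⟩
  obtain ⟨U, hU⟩ := LinearIsometry.exists_extension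
    ((A.subtypeₗᵢ.lTensor (EuclideanSpace ℂ (Fin n))).comp T) j
  have h1 : U.toLinearMap ∘ₗ A.subtype = A.subtype.lTensor _ ∘ₗ T.toLinearMap := by
    ext u; exact hU u
  have h2 : ∀ i, U.toLinearMap ∘ₗ E i ∘ₗ A.subtype =
      TensorProduct.map (Matrix.toEuclideanLin (idealProjection n i)) A.subtype ∘ₗ
        T.toLinearMap := by
    intro i
    have hE : E i ∘ₗ A.subtype = A.subtype ∘ₗ (E i).restrict (hinv i) := rfl
    rw [hE, ← LinearMap.comp_assoc, h1, LinearMap.comp_assoc, ← LinearMap.lTensor_comp_rTensor,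
      LinearMap.comp_assoc]
    congr 1
    ext u; exact hT i u
  have h3 : ∀ X : EuclideanSpace ℂ (Fin n) →ₗ[ℂ] EuclideanSpace ℂ (Fin n),
      TensorProduct.map (LinearMap.id - X) A.subtype =
        A.subtype.lTensor _ - TensorProduct.map X A.subtype := by
    intro X; ext x y; simp [TensorProduct.sub_tmul]
  refine ⟨U, fun i a => ?_⟩
  fin_cases a
  · exact h2 i
  · change U.toLinearMap ∘ₗ (1 - E i) ∘ₗ A.subtype =
      TensorProduct.map (Matrix.toEuclideanLin (1 - idealProjection n i)) A.subtype ∘ₗ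
        T.toLinearMap
    rw [LinearMap.sub_comp, LinearMap.comp_sub, h2, Module.End.one_eq_id, LinearMap.id_comp, h1,
      map_sub, Matrix.toLpLin_one, h3, LinearMap.sub_comp]

/-- If binary measurements of two parties satisfy on the vector `ψ` the relations of the ideal
projections, then the ideal strategy is a local dilation of the given one. -/
theorem exists_isometry_of_relations (hn : 1 ≤ n) {ψ : V ⊗[ℂ] W} (hψ : ‖ψ‖ = 1)
    {E : Fin 4 → V →ₗ[ℂ] V} {F : Fin 4 → W →ₗ[ℂ] W}
    (hE : ∀ i, star (E i) = E i) (hF : ∀ i, star (F i) = F i)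
    (hEF : ∀ i, (E i).rTensor W ψ = (F i).lTensor V ψ)
    (hidem : ∀ i, (E i * E i).rTensor W ψ = (E i).rTensor W ψ)
    (hsum : (∑ i, E i).rTensor W ψ = (2 - 1 / n : ℂ) • ψ)
    (hdiff : (vectorState ψ (E 0 - E 1)).re = 1 / n) :
    ∃ (UA : V →ₗᵢ[ℂ] EuclideanSpace ℂ (Fin n) ⊗[ℂ] V)
      (UB : W →ₗᵢ[ℂ] EuclideanSpace ℂ (Fin n) ⊗[ℂ] W) (aux : V ⊗[ℂ] W),
      ‖aux‖ = 1 ∧ ∀ a b i j,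
        TensorProduct.map UA.toLinearMap UB.toLinearMap
            (TensorProduct.map (binaryOutcome (E i) a) (binaryOutcome (F j) b) ψ) =
          TensorProduct.tensorTensorTensorComm ℂ _ _ V W
            (TensorProduct.map (Matrix.toEuclideanLin (binaryOutcome (idealProjection n i) a))
              (Matrix.toEuclideanLin (binaryOutcome (idealProjection n j) b))
              (maxEntangledVec (EuclideanSpace.basisFun (Fin n) ℂ)) ⊗ₜ[ℂ] aux) := by
  obtain ⟨A, B, ξ, rfl, hA, hB⟩ := exists_support ψ
  have hinvA : ∀ i, ∀ v ∈ A, E i v ∈ A := by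
    intro i
    have : A.mkQ ∘ₗ E i ∘ₗ A.subtype = 0 := by
      apply hA
      have h := congrArg (A.mkQ.rTensor W) (hEF i)
      simp only [← LinearMap.comp_apply, LinearMap.rTensor_comp_map, LinearMap.lTensor_comp_map]
        at h
      have h0 : A.mkQ ∘ₗ A.subtype = 0 := by ext; simp
      rw [h, h0, TensorProduct.map_zero_left, LinearMap.zero_apply]
    intro v hv
    simpa using LinearMap.congr_fun this ⟨v, hv⟩
  have hinvB : ∀ i, ∀ w ∈ B, F i w ∈ B := by
    intro i
    have : B.mkQ ∘ₗ F i ∘ₗ B.subtype = 0 := by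
      apply hB
      have h := congrArg (B.mkQ.lTensor V) (hEF i)
      simp only [← LinearMap.comp_apply, LinearMap.rTensor_comp_map, LinearMap.lTensor_comp_map]
        at h
      have h0 : B.mkQ ∘ₗ B.subtype = 0 := by ext; simp
      rw [← h, h0, TensorProduct.map_zero_right, LinearMap.zero_apply]
    intro w hw
    simpa using LinearMap.congr_fun this ⟨w, hw⟩
  let E' : Fin 4 → A →ₗ[ℂ] A := fun i => (E i).restrict (hinvA i)
  let F' : Fin 4 → B →ₗ[ℂ] B := fun i => (F i).restrict (hinvB i)
  have hE' : ∀ i, A.subtype ∘ₗ E' i = E i ∘ₗ A.subtype := fun i => rfl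
  have hF' : ∀ i, B.subtype ∘ₗ F' i = F i ∘ₗ B.subtype := fun i => rfl
  have hzero : ∀ X : V →ₗ[ℂ] V, X.rTensor W (TensorProduct.map A.subtype B.subtype ξ) = 0 →
      X ∘ₗ A.subtype = 0 := by
    intro X hX
    apply hA
    rwa [← LinearMap.comp_apply, LinearMap.rTensor_comp_map] at hX
  have hinner : ∀ x y : A ⊗[ℂ] B, inner ℂ (TensorProduct.map A.subtype B.subtype x)
      (TensorProduct.map A.subtype B.subtype y) = inner ℂ x y := fun x y =>
    TensorProduct.inner_map_map A.subtypeₗᵢ B.subtypeₗᵢ x y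
  have hnorm : ∀ x : A ⊗[ℂ] B, ‖TensorProduct.map A.subtype B.subtype x‖ = ‖x‖ := fun x =>
    TensorProduct.norm_map A.subtypeₗᵢ B.subtypeₗᵢ x
  have hinj : Function.Injective (TensorProduct.map A.subtype B.subtype) :=
    (TensorProduct.mapIsometry A.subtypeₗᵢ B.subtypeₗᵢ).injective
  obtain ⟨T, T', aux, haux, hT, hT', hTT⟩ := exists_isometry_of_fullSupport hn (ψ := ξ)
    (E := E') (F := F') (by rw [← hψ, hnorm])
    (fun Z hZ => by
      apply hA
      rw [← LinearMap.lTensor_comp_rTensor, LinearMap.comp_apply, hZ, map_zero])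
    (fun Z hZ => by
      apply hB
      rw [← LinearMap.rTensor_comp_lTensor, LinearMap.comp_apply, hZ, map_zero])
    (fun i => star_restrict_eq (hE i) _) (fun i => star_restrict_eq (hF i) _)
    (fun i => by
      apply hinj
      have h := hEF i
      simp only [← LinearMap.comp_apply, LinearMap.rTensor_comp_map, LinearMap.lTensor_comp_map]
        at h
      simp only [← LinearMap.comp_apply, LinearMap.map_comp_rTensor, LinearMap.map_comp_lTensor,
        hE', hF']
      exact h)
    (fun i => by
      have h := hzero (E i * E i - E i) (by
        rw [LinearMap.rTensor_sub, LinearMap.sub_apply, hidem, sub_self])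
      ext u
      have := LinearMap.congr_fun h u
      rw [LinearMap.comp_apply, LinearMap.sub_apply, LinearMap.zero_apply, sub_eq_zero] at this
      exact this)
    (by
      have h := hzero (∑ i, E i - (2 - 1 / n : ℂ) • 1) (by
        rw [LinearMap.rTensor_sub, LinearMap.sub_apply, hsum, LinearMap.rTensor_smul,
          LinearMap.smul_apply, Module.End.one_eq_id, LinearMap.rTensor_id_apply, sub_self])
      ext u
      have := LinearMap.congr_fun h u
      rw [LinearMap.comp_apply, LinearMap.sub_apply, LinearMap.zero_apply, sub_eq_zero] at this
      simpa [LinearMap.sum_apply, E'] using this)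
    (by
      rw [← hdiff, vectorState_apply, vectorState_apply, ← hinner]
      congr 2
      simp only [← LinearMap.comp_apply, LinearMap.map_comp_rTensor, LinearMap.rTensor_comp_map]
      congr 2)
  obtain ⟨UA, keyA⟩ := exists_extension_intertwining hn hinvA T hT
  obtain ⟨UB, keyB⟩ := exists_extension_intertwining hn hinvB T' hT'
  refine ⟨UA, UB, TensorProduct.map A.subtype B.subtype aux, by rw [hnorm, haux], ?_⟩
  intro a b i j
  rw [← LinearMap.comp_apply, ← LinearMap.comp_apply, ← TensorProduct.map_comp,
    ← TensorProduct.map_comp, LinearMap.comp_assoc, LinearMap.comp_assoc, keyA, keyB,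
    TensorProduct.map_comp, LinearMap.comp_apply, hTT, tensorTensorTensorComm_map]

end selfTest

/-! ### Relations from correlations -/

section positivity

variable {V W : Type} [NormedAddCommGroup V] [InnerProductSpace ℂ V] [FiniteDimensional ℂ V]
  [NormedAddCommGroup W] [InnerProductSpace ℂ W] [FiniteDimensional ℂ W]

lemma LinearMap.IsPositive.exists_star_mul_self {X : V →ₗ[ℂ] V} (hX : X.IsPositive) :
    ∃ Z : V →ₗ[ℂ] V, X = star Z * Z := by
  have h : (LinearMap.toContinuousLinearMap X).IsPositive :=
    (LinearMap.isPositive_toContinuousLinearMap_iff X).2 hX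
  rw [← ContinuousLinearMap.nonneg_iff_isPositive, CStarAlgebra.nonneg_iff_eq_star_mul_self] at h
  obtain ⟨Z, hZ⟩ := h
  refine ⟨Z.toLinearMap, ?_⟩
  ext v
  exact congrArg (fun f : V →L[ℂ] V => f v) hZ

/-- A product of positive operators with vanishing expectation annihilates the vector. -/
lemma map_eq_zero_of_inner_eq_zero {X : V →ₗ[ℂ] V} {Y : W →ₗ[ℂ] W} (hX : X.IsPositive)
    (hY : Y.IsPositive) {ψ : V ⊗[ℂ] W} (h : inner ℂ ψ (TensorProduct.map X Y ψ) = 0) :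
    TensorProduct.map X Y ψ = 0 := by
  obtain ⟨Z, rfl⟩ := hX.exists_star_mul_self
  obtain ⟨Z', rfl⟩ := hY.exists_star_mul_self
  rw [TensorProduct.map_mul, Module.End.mul_apply] at h ⊢
  rw [LinearMap.star_eq_adjoint, LinearMap.star_eq_adjoint, ← TensorProduct.adjoint_map,
    LinearMap.adjoint_inner_right, inner_self_eq_zero] at h
  rw [h, map_zero]

end positivity

lemma inner_sum_sub_smul_of_gram {H ι : Type*} [NormedAddCommGroup H] [InnerProductSpace ℂ H]
    [Fintype ι] {x : H} {f : ι → H} {g : ι → ι → ℂ} (α : ℂ) (hx : inner ℂ x x = 1)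
    (hff : ∀ i j, inner ℂ (f i) (f j) = g i j) (hxf : ∀ i, inner ℂ x (f i) = g i i)
    (hfx : ∀ i, inner ℂ (f i) x = g i i) :
    inner ℂ (∑ i, f i - α • x) (∑ i, f i - α • x) =
      ∑ i, ∑ j, g i j - (α + star α) * ∑ i, g i i + star α * α := by
  rw [inner_sub_left, inner_sub_right, inner_sub_right, inner_smul_left, inner_smul_left,
    inner_smul_right, inner_smul_right, hx]
  simp only [sum_inner, inner_sum, hff, hxf, hfx]
  rw [Complex.star_def, Finset.sum_comm]
  ring

namespace BipartiteStrategy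

variable {HA HB : Type}
  [NormedAddCommGroup HA] [InnerProductSpace ℂ HA] [FiniteDimensional ℂ HA]
  [NormedAddCommGroup HB] [InnerProductSpace ℂ HB] [FiniteDimensional ℂ HB]
variable {N : ℕ}

lemma effect_eq_binaryOutcome {H : Type} [NormedAddCommGroup H] [InnerProductSpace ℂ H]
    (M : POVM 2 H) (a : Fin 2) : M.effect a = binaryOutcome (M.effect 0) a := by
  have := M.sum_effect
  rw [Fin.sum_univ_two] at this
  fin_cases a
  · rfl
  · exact eq_sub_of_add_eq' this

lemma star_effect {H : Type} [NormedAddCommGroup H] [InnerProductSpace ℂ H]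
    [FiniteDimensional ℂ H] {K : ℕ} (M : POVM K H) (a : Fin K) :
    star (M.effect a) = M.effect a := (M.isPositive a).adjoint_eq

/-- If both parties always give equal answers to equal questions, then their effects act in the
same way on the state. -/
lemma rTensor_eq_lTensor_of_synchronous (S : BipartiteStrategy N N 2 2 HA HB) {i : Fin N}
    (h01 : S.correlation 0 1 i i = 0) (h10 : S.correlation 1 0 i i = 0) :
    ((S.measA i).effect 0).rTensor HB S.state = ((S.measB i).effect 0).lTensor HA S.state := by
  have h1 := map_eq_zero_of_inner_eq_zero ((S.measA i).isPositive 0) ((S.measB i).isPositive 1) h01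
  have h2 := map_eq_zero_of_inner_eq_zero ((S.measA i).isPositive 1) ((S.measB i).isPositive 0) h10
  rw [effect_eq_binaryOutcome (S.measB i) 1] at h1
  rw [effect_eq_binaryOutcome (S.measA i) 1] at h2
  simp only [binaryOutcome, Matrix.cons_val_one, Matrix.cons_val_fin_one] at h1 h2
  have e1 : TensorProduct.map ((S.measA i).effect 0) (1 - (S.measB i).effect 0) =
      ((S.measA i).effect 0).rTensor HB -
        TensorProduct.map ((S.measA i).effect 0) ((S.measB i).effect 0) := by
    ext x y; simp [TensorProduct.tmul_sub]
  have e2 : TensorProduct.map (1 - (S.measA i).effect 0) ((S.measB i).effect 0) =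
      ((S.measB i).effect 0).lTensor HA -
        TensorProduct.map ((S.measA i).effect 0) ((S.measB i).effect 0) := by
    ext x y; simp [TensorProduct.sub_tmul]
  rw [e1, LinearMap.sub_apply, sub_eq_zero] at h1
  rw [e2, LinearMap.sub_apply, sub_eq_zero] at h2
  rw [h1, h2]

/-- For a synchronous strategy, the effects of the first party act as projections. -/
lemma rTensor_mul_self_of_synchronous (S : BipartiteStrategy N N 2 2 HA HB) {i : Fin N}
    (h01 : S.correlation 0 1 i i = 0) (h10 : S.correlation 1 0 i i = 0) :
    ((S.measA i).effect 0 * (S.measA i).effect 0).rTensor HB S.state =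
      ((S.measA i).effect 0).rTensor HB S.state := by
  have h1 := map_eq_zero_of_inner_eq_zero ((S.measA i).isPositive 0) ((S.measB i).isPositive 1) h01
  rw [effect_eq_binaryOutcome (S.measB i) 1] at h1
  simp only [binaryOutcome, Matrix.cons_val_one, Matrix.cons_val_fin_one] at h1
  have e1 : TensorProduct.map ((S.measA i).effect 0) (1 - (S.measB i).effect 0) =
      ((S.measA i).effect 0).rTensor HB -
        ((S.measA i).effect 0).rTensor HB ∘ₗ ((S.measB i).effect 0).lTensor HA := by
    ext x y; simp [TensorProduct.tmul_sub]
  rw [e1, LinearMap.sub_apply, sub_eq_zero, LinearMap.comp_apply,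
    ← S.rTensor_eq_lTensor_of_synchronous h01 h10] at h1
  rw [LinearMap.rTensor_mul_eq, ← h1]

/-- The inner products of the vectors `E i ψ` are correlations. -/
lemma inner_rTensor_rTensor (S : BipartiteStrategy N N 2 2 HA HB) {j : Fin N}
    (hj : ((S.measA j).effect 0).rTensor HB S.state = ((S.measB j).effect 0).lTensor HA S.state)
    (i : Fin N) :
    inner ℂ (((S.measA i).effect 0).rTensor HB S.state)
      (((S.measA j).effect 0).rTensor HB S.state) = S.correlation 0 0 i j := by
  rw [← LinearMap.adjoint_inner_right, LinearMap.adjoint_rTensor, ← LinearMap.star_eq_adjoint,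
    star_effect, hj, ← LinearMap.comp_apply, LinearMap.rTensor_comp_lTensor]
  rfl

lemma inner_state_rTensor (S : BipartiteStrategy N N 2 2 HA HB) {i : Fin N}
    (hi : ((S.measA i).effect 0).rTensor HB S.state = ((S.measB i).effect 0).lTensor HA S.state)
    (hidem : ((S.measA i).effect 0 * (S.measA i).effect 0).rTensor HB S.state =
      ((S.measA i).effect 0).rTensor HB S.state) :
    inner ℂ S.state (((S.measA i).effect 0).rTensor HB S.state) = S.correlation 0 0 i i := by
  rw [← S.inner_rTensor_rTensor hi, ← hidem, LinearMap.rTensor_mul_eq,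
    ← LinearMap.adjoint_inner_left, LinearMap.adjoint_rTensor, ← LinearMap.star_eq_adjoint,
    star_effect, ← LinearMap.rTensor_mul_eq, hidem]

lemma inner_rTensor_state (S : BipartiteStrategy N N 2 2 HA HB) {i : Fin N}
    (hi : ((S.measA i).effect 0).rTensor HB S.state = ((S.measB i).effect 0).lTensor HA S.state)
    (hidem : ((S.measA i).effect 0 * (S.measA i).effect 0).rTensor HB S.state =
      ((S.measA i).effect 0).rTensor HB S.state) :
    inner ℂ (((S.measA i).effect 0).rTensor HB S.state) S.state = S.correlation 0 0 i i := by
  rw [← S.inner_state_rTensor hi hidem, ← LinearMap.adjoint_inner_right, LinearMap.adjoint_rTensor,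
    ← LinearMap.star_eq_adjoint, star_effect]

/-- The squared norm of `∑ E i ψ - α ψ` is determined by the correlation. -/
lemma inner_sum_sub_smul (S : BipartiteStrategy N N 2 2 HA HB)
    (hAB : ∀ i, ((S.measA i).effect 0).rTensor HB S.state =
      ((S.measB i).effect 0).lTensor HA S.state)
    (hidem : ∀ i, ((S.measA i).effect 0 * (S.measA i).effect 0).rTensor HB S.state =
      ((S.measA i).effect 0).rTensor HB S.state) (α : ℂ) :
    inner ℂ ((∑ i, (S.measA i).effect 0).rTensor HB S.state - α • S.state)
        ((∑ i, (S.measA i).effect 0).rTensor HB S.state - α • S.state) =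
      ∑ i, ∑ j, S.correlation 0 0 i j - (α + star α) * ∑ i, S.correlation 0 0 i i +
        star α * α := by
  have hsum : (∑ i, (S.measA i).effect 0).rTensor HB S.state =
      ∑ i, ((S.measA i).effect 0).rTensor HB S.state := by
    simp only [← LinearMap.coe_rTensorHom, map_sum, LinearMap.sum_apply]
  have hone : inner ℂ S.state S.state = 1 :=
    (inner_self_eq_norm_sq_to_K (𝕜 := ℂ) S.state).trans (by simp [S.norm_state])
  rw [hsum]
  exact inner_sum_sub_smul_of_gram α hone (fun i j => S.inner_rTensor_rTensor (hAB j) i)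
    (fun i => S.inner_state_rTensor (hAB i) (hidem i))
    (fun i => S.inner_rTensor_state (hAB i) (hidem i))

end BipartiteStrategy

/-! ### Strategies on the maximally entangled state -/

section maxEntangled

variable {n : ℕ}

local notation "φ" => maxEntangledVec (EuclideanSpace.basisFun (Fin n) ℂ)

/-- An operator of one party acts on the maximally entangled state as its transpose does for the
other party. -/
lemma rTensor_maxEntangledVec (X : Matrix (Fin n) (Fin n) ℂ) :
    (Matrix.toEuclideanLin X).rTensor (EuclideanSpace ℂ (Fin n)) φ =
      (Matrix.toEuclideanLin X.transpose).lTensor (EuclideanSpace ℂ (Fin n)) φ := by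
  simp only [maxEntangledVec, map_smul, map_sum, LinearMap.rTensor_tmul, LinearMap.lTensor_tmul,
    toEuclideanLin_basisFun, TensorProduct.sum_tmul, TensorProduct.tmul_sum,
    ← TensorProduct.smul_tmul', TensorProduct.tmul_smul, Matrix.transpose_apply]
  rw [Finset.sum_comm]

lemma inner_maxEntangledVec_rTensor (X : Matrix (Fin n) (Fin n) ℂ) :
    inner ℂ φ ((Matrix.toEuclideanLin X).rTensor (EuclideanSpace ℂ (Fin n)) φ) = X.trace / n := by
  have hb := orthonormal_iff_ite.1 (EuclideanSpace.basisFun (Fin n) ℂ).orthonormal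
  have h1 : ∀ i j : Fin n, inner ℂ
      (EuclideanSpace.basisFun (Fin n) ℂ i ⊗ₜ[ℂ] EuclideanSpace.basisFun (Fin n) ℂ i)
      ((Matrix.toEuclideanLin X).rTensor (EuclideanSpace ℂ (Fin n))
        (EuclideanSpace.basisFun (Fin n) ℂ j ⊗ₜ[ℂ] EuclideanSpace.basisFun (Fin n) ℂ j)) =
      if i = j then X i i else 0 := by
    intro i j
    rw [LinearMap.rTensor_tmul, TensorProduct.inner_tmul, toEuclideanLin_basisFun, inner_sum, hb]
    simp only [inner_smul_right, hb]
    split_ifs with h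
    · subst h; simp
    · simp
  have h2 : (((Real.sqrt n : ℂ))⁻¹) * ((Real.sqrt n : ℂ))⁻¹ = (n : ℂ)⁻¹ := by
    rw [← mul_inv, ← Complex.ofReal_mul, Real.mul_self_sqrt (by positivity), Complex.ofReal_natCast]
  have h3 : ∀ (c : ℂ) (x y : EuclideanSpace ℂ (Fin n) ⊗[ℂ] EuclideanSpace ℂ (Fin n)),
      inner ℂ (c • x) (c • y) = star c * c * inner ℂ x y := by
    intro c x y
    exact (inner_smul_left x (c • y) c).trans (by
      rw [mul_assoc]; exact congrArg _ (inner_smul_right x y c))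
  rw [maxEntangledVec, map_smul, h3, map_sum, sum_inner]
  simp only [inner_sum, h1]
  rw [Complex.star_def, map_inv₀, Complex.conj_ofReal, h2, Matrix.trace]
  simp [div_eq_inv_mul]

lemma norm_maxEntangledVec (hn : 1 ≤ n) : ‖φ‖ = 1 := by
  have h := inner_maxEntangledVec_rTensor (1 : Matrix (Fin n) (Fin n) ℂ)
  have hn' : (n : ℂ) ≠ 0 := by exact_mod_cast (by omega : n ≠ 0)
  rw [Matrix.toLpLin_one, LinearMap.rTensor_id_apply, Matrix.trace_one, Fintype.card_fin,
    div_self hn'] at h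
  have h' : (‖φ‖ : ℂ) ^ 2 = 1 := (inner_self_eq_norm_sq_to_K (𝕜 := ℂ) φ).symm.trans h
  have h2 : ‖φ‖ ^ 2 = 1 := by exact_mod_cast h'
  exact (pow_eq_one_iff_of_nonneg (norm_nonneg _) two_ne_zero).1 h2

open scoped ComplexOrder in
lemma IsStarProjection.isPositive_toEuclideanLin {Q : Matrix (Fin n) (Fin n) ℂ}
    (hQ : IsStarProjection Q) : (Matrix.toEuclideanLin Q).IsPositive := by
  rw [Matrix.isPositive_toEuclideanLin_iff]
  have := Matrix.posSemidef_conjTranspose_mul_self Q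
  rwa [← Matrix.star_eq_conjTranspose, hQ.isSelfAdjoint.star_eq, hQ.isIdempotentElem.eq] at this

/-- The binary projective measurement `(P, 1 - P)` on `ℂⁿ`. -/
noncomputable def projectivePOVM (P : Matrix (Fin n) (Fin n) ℂ) (hP : IsStarProjection P) :
    POVM 2 (EuclideanSpace ℂ (Fin n)) where
  effect a := Matrix.toEuclideanLin (binaryOutcome P a)
  isPositive a := by
    fin_cases a
    · exact hP.isPositive_toEuclideanLin
    · exact hP.one_sub.isPositive_toEuclideanLin
  sum_effect := by
    rw [Fin.sum_univ_two, ← map_add]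
    simp [binaryOutcome, Module.End.one_eq_id]

/-- The strategy with a maximally entangled state in which the two parties measure the given
projections. -/
noncomputable def projectiveStrategy (hn : 1 ≤ n) (P Q : Fin 4 → Matrix (Fin n) (Fin n) ℂ)
    (hP : ∀ i, IsStarProjection (P i)) (hQ : ∀ i, IsStarProjection (Q i)) :
    SquareStrategy 4 2 n where
  state := φ
  norm_state := norm_maxEntangledVec hn
  measA i := projectivePOVM (P i) (hP i)
  measB i := projectivePOVM (Q i) (hQ i)

lemma isStarProjection_idealProjection (hn : 1 ≤ n) (i : Fin 4) :
    IsStarProjection (idealProjection n i) :=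
  ⟨idealProjection_mul_self hn i, star_idealProjection hn i⟩

/-- The strategy in which both parties measure the ideal projections, which are real and thus
equal to their transposes. -/
noncomputable def idealStrategy (hn : 1 ≤ n) : SquareStrategy 4 2 n :=
  projectiveStrategy hn (idealProjection n) (idealProjection n)
    (isStarProjection_idealProjection hn) (isStarProjection_idealProjection hn)

lemma trace_pathMatrix_evenEdge (hn : 1 ≤ n) : (pathMatrix n evenEdge).trace = 1 := by
  rw [Matrix.trace, Finset.sum_eq_single ⟨0, hn⟩]
  · simp [pathMatrix, evenEdge, edgeWeight_zero]
  · intro i _ hi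
    have h0 : (i : ℕ) ≠ 0 := fun h => hi (Fin.ext h)
    have : (i : ℕ) ≠ 2 * evenEdge i - 1 - i := by unfold evenEdge; omega
    simp [pathMatrix, this]
  · simp

lemma idealProjection_zero_sub_one :
    idealProjection n 0 - idealProjection n 1 = pathMatrix n evenEdge := by
  simp only [idealProjection, pathProjections, Matrix.cons_val_zero, Matrix.cons_val_one]
  module

end maxEntangled

namespace BipartiteStrategy

/-- The ideal strategy is self-tested: its correlation is synchronous and thus forces, for every
other strategy with the same correlation, the relations of the ideal projections on the state. -/
theorem isSelfTested_idealStrategy {n : ℕ} (hn : 1 ≤ n) : (idealStrategy hn).IsSelfTested := by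
  intro HA HB _ _ _ _ _ _ S hS
  set T := idealStrategy hn with hT
  have hTP : ∀ i, (T.measA i).effect 0 = Matrix.toEuclideanLin (idealProjection n i) := fun i => rfl
  have hTAB : ∀ i, ((T.measA i).effect 0).rTensor _ T.state =
      ((T.measB i).effect 0).lTensor _ T.state := by
    intro i
    have := rTensor_maxEntangledVec (idealProjection n i)
    rwa [transpose_idealProjection] at this
  have hTmul : ∀ i, (T.measA i).effect 0 * (T.measA i).effect 0 = (T.measA i).effect 0 := by
    intro i
    rw [hTP, Module.End.mul_eq_comp, ← Matrix.toLpLin_mul_same, idealProjection_mul_self hn]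
  have hTsum : ∑ i, (T.measA i).effect 0 = (2 - 1 / n : ℂ) • 1 := by
    simp only [hTP]
    rw [← map_sum, sum_idealProjection, map_smul, Matrix.toLpLin_one, Module.End.one_eq_id]
  have hT01 : ∀ i, T.correlation 0 1 i i = 0 := by
    intro i
    have h1 : T.outcomeVec 0 1 i i = 0 := by
      have e : T.outcomeVec 0 1 i i = TensorProduct.map (Matrix.toEuclideanLin (idealProjection n i))
        (Matrix.toEuclideanLin (1 - idealProjection n i)) T.state := rfl
      have e2 : T.state = maxEntangledVec (EuclideanSpace.basisFun (Fin n) ℂ) := rfl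
      rw [e, e2, ← LinearMap.rTensor_comp_lTensor, LinearMap.comp_apply,
        ← transpose_idealProjection, ← Matrix.transpose_one, ← Matrix.transpose_sub,
        ← rTensor_maxEntangledVec, transpose_idealProjection, ← LinearMap.rTensor_mul_eq,
        Module.End.mul_eq_comp, ← Matrix.toLpLin_mul_same, mul_sub, mul_one,
        idealProjection_mul_self hn]
      simp
    rw [correlation, h1, inner_zero_right]
  have hT10 : ∀ i, T.correlation 1 0 i i = 0 := by
    intro i
    have h1 : T.outcomeVec 1 0 i i = 0 := by
      have e : T.outcomeVec 1 0 i i =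
        TensorProduct.map (Matrix.toEuclideanLin (1 - idealProjection n i))
        (Matrix.toEuclideanLin (idealProjection n i)) T.state := rfl
      have e2 : T.state = maxEntangledVec (EuclideanSpace.basisFun (Fin n) ℂ) := rfl
      rw [e, e2, ← LinearMap.rTensor_comp_lTensor, LinearMap.comp_apply]
      nth_rw 2 [← transpose_idealProjection]
      rw [← rTensor_maxEntangledVec, ← LinearMap.rTensor_mul_eq,
        Module.End.mul_eq_comp, ← Matrix.toLpLin_mul_same, sub_mul, one_mul,
        idealProjection_mul_self hn]
      simp
    rw [correlation, h1, inner_zero_right]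
  have hAB := fun i => S.rTensor_eq_lTensor_of_synchronous (i := i) (by rw [hS, hT01])
    (by rw [hS, hT10])
  have hidem := fun i => S.rTensor_mul_self_of_synchronous (i := i) (by rw [hS, hT01])
    (by rw [hS, hT10])
  have hTidem : ∀ i, ((T.measA i).effect 0 * (T.measA i).effect 0).rTensor _ T.state =
      ((T.measA i).effect 0).rTensor _ T.state := fun i => by rw [hTmul]
  -- The squared norm of the difference is the same function of the correlation for `S` and for `T`.
  have hsum : (∑ i, (S.measA i).effect 0).rTensor HB S.state = (2 - 1 / n : ℂ) • S.state := by
    rw [← sub_eq_zero, ← inner_self_eq_zero (𝕜 := ℂ)]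
    refine (S.inner_sum_sub_smul hAB hidem _).trans ?_
    rw [hS, ← T.inner_sum_sub_smul hTAB hTidem, hTsum, LinearMap.rTensor_smul, LinearMap.smul_apply,
      Module.End.one_eq_id, LinearMap.rTensor_id_apply, sub_self, inner_zero_left]
  have hdiff : (vectorState S.state ((S.measA 0).effect 0 - (S.measA 1).effect 0)).re = 1 / n := by
    have hS1 : vectorState S.state ((S.measA 0).effect 0 - (S.measA 1).effect 0) =
        T.correlation 0 0 0 0 - T.correlation 0 0 1 1 := by
      rw [map_sub, vectorState_apply, vectorState_apply, S.inner_state_rTensor (hAB 0) (hidem 0),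
        S.inner_state_rTensor (hAB 1) (hidem 1), hS]
    have hT1 : vectorState T.state ((T.measA 0).effect 0 - (T.measA 1).effect 0) =
        T.correlation 0 0 0 0 - T.correlation 0 0 1 1 := by
      rw [map_sub, vectorState_apply, vectorState_apply, T.inner_state_rTensor (hTAB 0) (hTidem 0),
        T.inner_state_rTensor (hTAB 1) (hTidem 1)]
    have h1 := inner_maxEntangledVec_rTensor (pathMatrix n evenEdge)
    rw [trace_pathMatrix_evenEdge hn, ← idealProjection_zero_sub_one, map_sub] at h1
    rw [hS1, ← hT1, vectorState_apply]
    refine (congrArg Complex.re h1).trans ?_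
    have : (1 / n : ℂ) = ((1 / n : ℝ) : ℂ) := by push_cast; rfl
    rw [this, Complex.ofReal_re]
  obtain ⟨UA, UB, aux, haux, h⟩ := exists_isometry_of_relations hn S.norm_state
    (fun i => star_effect (S.measA i) 0) (fun i => star_effect (S.measB i) 0) hAB hidem hsum hdiff
  refine ⟨HA, HB, _, _, inferInstance, _, _, inferInstance, aux, UA, UB, haux, fun a b i j => ?_⟩
  rw [outcomeVec, effect_eq_binaryOutcome (S.measA i), effect_eq_binaryOutcome (S.measB j)]
  exact h a b i j

end BipartiteStrategy

/-! ### Symmetries of self-tested strategies -/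

namespace BipartiteStrategy

section symmetries

variable {NA NB : ℕ} {KA KB : ℕ}
variable {GA GB GA' GB' : Type}
  [NormedAddCommGroup GA] [InnerProductSpace ℂ GA]
  [NormedAddCommGroup GB] [InnerProductSpace ℂ GB]
  [NormedAddCommGroup GA'] [InnerProductSpace ℂ GA']
  [NormedAddCommGroup GB'] [InnerProductSpace ℂ GB']

/-- Self-testing is invariant under local isometries that intertwine the measurements. -/
lemma IsSelfTested.of_isometry {T : BipartiteStrategy NA NB KA KB GA GB}
    {T' : BipartiteStrategy NA NB KA KB GA' GB'} (hT : T.IsSelfTested)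
    (VA : GA →ₗᵢ[ℂ] GA') (VB : GB →ₗᵢ[ℂ] GB')
    (hstate : TensorProduct.map VA.toLinearMap VB.toLinearMap T.state = T'.state)
    (hA : ∀ i a, (T'.measA i).effect a ∘ₗ VA.toLinearMap =
      VA.toLinearMap ∘ₗ (T.measA i).effect a)
    (hB : ∀ j b, (T'.measB j).effect b ∘ₗ VB.toLinearMap =
      VB.toLinearMap ∘ₗ (T.measB j).effect b) :
    T'.IsSelfTested := by
  have hout : ∀ a b i j, T'.outcomeVec a b i j =
      TensorProduct.map VA.toLinearMap VB.toLinearMap (T.outcomeVec a b i j) := by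
    intro a b i j
    rw [outcomeVec, outcomeVec, ← hstate, ← LinearMap.comp_apply, ← LinearMap.comp_apply,
      ← TensorProduct.map_comp, ← TensorProduct.map_comp, hA, hB]
  have hcorr : T'.correlation = T.correlation := by
    funext a b i j
    rw [correlation, correlation, hout, ← hstate]
    exact TensorProduct.inner_map_map VA VB _ _
  intro HA HB _ _ _ _ _ _ S hS
  obtain ⟨LA, LB, i₁, i₂, i₃, i₄, i₅, i₆, aux, UA, UB, haux, h⟩ :=
    hT HA HB S (hS.trans hcorr)
  refine ⟨LA, LB, i₁, i₂, i₃, i₄, i₅, i₆, aux, (VA.rTensor LA).comp UA, (VB.rTensor LB).comp UB,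
    haux, fun a b i j => ?_⟩
  have e : TensorProduct.map ((VA.rTensor LA).comp UA).toLinearMap
      ((VB.rTensor LB).comp UB).toLinearMap =
      TensorProduct.map (TensorProduct.map VA.toLinearMap LinearMap.id)
        (TensorProduct.map VB.toLinearMap LinearMap.id) ∘ₗ
        TensorProduct.map UA.toLinearMap UB.toLinearMap := by
    rw [← TensorProduct.map_comp]; rfl
  rw [e, LinearMap.comp_apply, h, tensorTensorTensorComm_map, hout, TensorProduct.map_id]
  rfl

/-- The measurement with its two outcomes exchanged. -/
def _root_.POVM.swap {H : Type} [NormedAddCommGroup H] [InnerProductSpace ℂ H] (M : POVM 2 H) :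
    POVM 2 H where
  effect a := M.effect a.rev
  isPositive a := M.isPositive a.rev
  sum_effect := by rw [← M.sum_effect, Fin.sum_univ_two, Fin.sum_univ_two, add_comm]; rfl

/-- The strategy with the outcomes of all its measurements exchanged. -/
def swapOutcomes (T : BipartiteStrategy NA NB 2 2 GA GB) : BipartiteStrategy NA NB 2 2 GA GB where
  state := T.state
  norm_state := T.norm_state
  measA i := (T.measA i).swap
  measB j := (T.measB j).swap

lemma IsSelfTested.swapOutcomes {T : BipartiteStrategy NA NB 2 2 GA GB} (hT : T.IsSelfTested) :
    T.swapOutcomes.IsSelfTested := by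
  intro HA HB _ _ _ _ _ _ S hS
  have hcorr : S.swapOutcomes.correlation = T.correlation := by
    funext a b i j
    have h1 : S.swapOutcomes.correlation a b i j = S.correlation a.rev b.rev i j := rfl
    have h2 : T.swapOutcomes.correlation a.rev b.rev i j =
      T.correlation a.rev.rev b.rev.rev i j := rfl
    rw [h1, hS, h2, Fin.rev_rev, Fin.rev_rev]
  obtain ⟨LA, LB, i₁, i₂, i₃, i₄, i₅, i₆, aux, UA, UB, haux, h⟩ := hT HA HB S.swapOutcomes hcorr
  refine ⟨LA, LB, i₁, i₂, i₃, i₄, i₅, i₆, aux, UA, UB, haux, fun a b i j => ?_⟩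
  have h1 : S.swapOutcomes.outcomeVec a.rev b.rev i j =
    S.outcomeVec a.rev.rev b.rev.rev i j := rfl
  have h2 := h a.rev b.rev i j
  rw [h1, Fin.rev_rev, Fin.rev_rev] at h2
  exact h2

end symmetries

end BipartiteStrategy

/-! ### Unitary rotations and ranks -/

section rotation

variable {n : ℕ}

/-- The isometry of `ℂⁿ` given by a unitary matrix. -/
noncomputable def unitaryIsometry (U : Matrix (Fin n) (Fin n) ℂ) (hU : star U * U = 1) :
    EuclideanSpace ℂ (Fin n) →ₗᵢ[ℂ] EuclideanSpace ℂ (Fin n) where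
  toLinearMap := Matrix.toEuclideanLin U
  norm_map' v := by
    have h := (Matrix.toEuclideanLin U).inner_star_mul_self_apply v
    rw [LinearMap.star_eq_adjoint, ← Matrix.toEuclideanLin_conjTranspose_eq_adjoint,
      Module.End.mul_eq_comp, ← Matrix.toLpLin_mul_same, ← Matrix.star_eq_conjTranspose, hU,
      Matrix.toLpLin_one, LinearMap.id_apply] at h
    have h' : (‖v‖ : ℂ) ^ 2 = (‖Matrix.toEuclideanLin U v‖ : ℂ) ^ 2 :=
      (inner_self_eq_norm_sq_to_K (𝕜 := ℂ) v).symm.trans h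
    have h2 : ‖v‖ ^ 2 = ‖Matrix.toEuclideanLin U v‖ ^ 2 := by exact_mod_cast h'
    exact ((pow_left_inj₀ (norm_nonneg _) (norm_nonneg _) two_ne_zero).1 h2).symm

lemma IsStarProjection.conj_unitary {R : Type*} [Ring R] [StarRing R] {P U : R}
    (hP : IsStarProjection P) (hU : star U * U = 1) : IsStarProjection (U * P * star U) where
  isIdempotentElem := by
    change U * P * star U * (U * P * star U) = _
    rw [mul_assoc, ← mul_assoc (star U), ← mul_assoc (star U), hU, one_mul, ← mul_assoc,
      mul_assoc U P P, hP.isIdempotentElem.eq]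
  isSelfAdjoint := by
    rw [isSelfAdjoint_iff, star_mul, star_mul, star_star, hP.isSelfAdjoint.star_eq, mul_assoc]

lemma map_maxEntangledVec {U W : Matrix (Fin n) (Fin n) ℂ} (h : W * U.transpose = 1) :
    TensorProduct.map (Matrix.toEuclideanLin U) (Matrix.toEuclideanLin W)
      (maxEntangledVec (EuclideanSpace.basisFun (Fin n) ℂ)) =
      maxEntangledVec (EuclideanSpace.basisFun (Fin n) ℂ) := by
  rw [← LinearMap.lTensor_comp_rTensor, LinearMap.comp_apply, rTensor_maxEntangledVec,
    ← LinearMap.lTensor_mul_eq, Module.End.mul_eq_comp, ← Matrix.toLpLin_mul_same, h,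
    Matrix.toLpLin_one, LinearMap.lTensor_id_apply]

/-- Rotating the ideal projections by a unitary `U` for one party and by its complex conjugate `W`
for the other party keeps the maximally entangled state and the self-testing property. -/
lemma isSelfTested_rotated (hn : 1 ≤ n) {U W : Matrix (Fin n) (Fin n) ℂ} (hU : star U * U = 1)
    (hW : star W * W = 1) (h : W * U.transpose = 1) :
    (projectiveStrategy hn (fun i => U * idealProjection n i * star U)
      (fun i => W * idealProjection n i * star W)
      (fun i => (isStarProjection_idealProjection hn i).conj_unitary hU)
      (fun i => (isStarProjection_idealProjection hn i).conj_unitary hW)).IsSelfTested := by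
  have key : ∀ (V : Matrix (Fin n) (Fin n) ℂ), star V * V = 1 → ∀ i a,
      Matrix.toEuclideanLin (binaryOutcome (V * idealProjection n i * star V) a) ∘ₗ
        Matrix.toEuclideanLin V =
      Matrix.toEuclideanLin V ∘ₗ Matrix.toEuclideanLin (binaryOutcome (idealProjection n i) a) := by
    intro V hV i a
    rw [← Matrix.toLpLin_mul_same, ← Matrix.toLpLin_mul_same]
    congr 1
    fin_cases a
    · simp [binaryOutcome, mul_assoc, hV]
    · simp [binaryOutcome, mul_assoc, hV, sub_mul, mul_sub]
  exact (BipartiteStrategy.isSelfTested_idealStrategy hn).of_isometry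
    (unitaryIsometry U hU) (unitaryIsometry W hW) (map_maxEntangledVec h) (key U hU) (key W hW)

/-- Two orthogonal projections of the same rank are unitarily equivalent. -/
lemma exists_unitary_conj {P P' : Matrix (Fin n) (Fin n) ℂ} (hP : IsStarProjection P)
    (hP' : IsStarProjection P') (hrank : P.rank = P'.rank) :
    ∃ U : Matrix (Fin n) (Fin n) ℂ, star U * U = 1 ∧ U * star U = 1 ∧ U * P' * star U = P := by
  set p := Matrix.toEuclideanLin P with hp
  set p' := Matrix.toEuclideanLin P' with hp'
  have hrk : ∀ Q : Matrix (Fin n) (Fin n) ℂ,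
      Module.finrank ℂ (LinearMap.range (Matrix.toEuclideanLin Q)) = Q.rank := fun Q =>
    (Matrix.rank_eq_finrank_range_toLin Q (EuclideanSpace.basisFun (Fin n) ℂ).toBasis
      (EuclideanSpace.basisFun (Fin n) ℂ).toBasis).symm
  have hdim : Module.finrank ℂ (LinearMap.range p') = Module.finrank ℂ (LinearMap.range p) := by
    rw [hp, hp', hrk, hrk, hrank]
  let e : LinearMap.range p' ≃ₗᵢ[ℂ] LinearMap.range p :=
    (stdOrthonormalBasis ℂ (LinearMap.range p')).equiv (stdOrthonormalBasis ℂ (LinearMap.range p))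
      (finCongr hdim)
  let g := ((LinearMap.range p).subtypeₗᵢ.comp e.toLinearIsometry).extend
  have hg : ∀ s : LinearMap.range p', g s = e s := fun s => by
    simp only [g, LinearIsometry.extend_apply]; rfl
  have idem : ∀ x, p (p x) = p x := fun x => by
    rw [hp, ← LinearMap.comp_apply, ← Matrix.toLpLin_mul_same, hP.isIdempotentElem.eq]
  have idem' : ∀ x, p' (p' x) = p' x := fun x => by
    rw [hp', ← LinearMap.comp_apply, ← Matrix.toLpLin_mul_same, hP'.isIdempotentElem.eq]
  have symm : ∀ x y, inner ℂ (p x) y = inner ℂ x (p y) :=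
    hP.isPositive_toEuclideanLin.isSymmetric
  have symm' : ∀ x y, inner ℂ (p' x) y = inner ℂ x (p' y) :=
    hP'.isPositive_toEuclideanLin.isSymmetric
  have hcomm : ∀ x, p (g x) = g (p' x) := by
    intro x
    have h1 : p (g (p' x)) = g (p' x) := by
      have := hg ⟨p' x, ⟨x, rfl⟩⟩
      obtain ⟨y, hy⟩ := (e ⟨p' x, ⟨x, rfl⟩⟩).2
      rw [← hy] at this
      change g (p' x) = p y at this
      rw [this, idem]
    have h2 : p (g (x - p' x)) = 0 := by
      have hmem : p (g (x - p' x)) ∈ LinearMap.range p := ⟨_, rfl⟩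
      have hs := hg (e.symm ⟨_, hmem⟩)
      rw [LinearIsometryEquiv.apply_symm_apply] at hs
      change _ = p (g (x - p' x)) at hs
      obtain ⟨z, hz⟩ := (e.symm ⟨_, hmem⟩).2
      rw [← inner_self_eq_zero (𝕜 := ℂ)]
      conv_lhs => rw [symm, idem, ← hs, ← hz]
      rw [LinearIsometry.inner_map_map, ← symm', map_sub, idem', sub_self, inner_zero_left]
    have h3 : g x = g (p' x) + g (x - p' x) := by rw [← map_add]; congr 1; abel
    rw [h3, map_add, h1, h2, add_zero]
  let U := Matrix.toEuclideanLin.symm g.toLinearMap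
  have hUg : Matrix.toEuclideanLin U = g.toLinearMap := LinearEquiv.apply_symm_apply _ _
  have hUU : star U * U = 1 := by
    apply (Matrix.toEuclideanLin (𝕜 := ℂ) (m := Fin n) (n := Fin n)).injective
    rw [Matrix.toLpLin_mul_same, Matrix.star_eq_conjTranspose,
      Matrix.toEuclideanLin_conjTranspose_eq_adjoint, hUg, Matrix.toLpLin_one]
    refine LinearMap.ext fun x => ext_inner_left ℂ fun y => ?_
    rw [LinearMap.comp_apply, LinearMap.adjoint_inner_right]
    exact g.inner_map_map y x
  have hUU' : U * star U = 1 := mul_eq_one_comm.1 hUU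
  have hPU : P * U = U * P' := by
    apply (Matrix.toEuclideanLin (𝕜 := ℂ) (m := Fin n) (n := Fin n)).injective
    rw [Matrix.toLpLin_mul_same, Matrix.toLpLin_mul_same, hUg]
    ext1 x
    exact hcomm x
  exact ⟨U, hUU, hUU', by rw [← hPU, mul_assoc, hUU', mul_one]⟩

lemma rank_eq_trace {P : Matrix (Fin n) (Fin n) ℂ} (hP : IsStarProjection P) :
    (P.rank : ℂ) = P.trace := by
  have h : IsIdempotentElem (Matrix.toLin' P) := by
    change Matrix.toLin' P * Matrix.toLin' P = _
    rw [Module.End.mul_eq_comp, ← Matrix.toLin'_mul, hP.isIdempotentElem.eq]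
  rw [← Matrix.trace_toLin'_eq, (LinearMap.IsIdempotentElem.isProj_range _ h).trace]
  rfl

lemma sum_siteValue (k : ℕ) :
    ∑ m ∈ Finset.range k, siteValue n m = if Even k then -(k / n : ℝ) else 0 := by
  induction k with
  | zero => simp
  | succ k ih =>
    rw [Finset.sum_range_succ, ih]
    rcases Nat.even_or_odd k with h | h
    · rw [if_pos h, if_neg (by grind), siteValue_of_even h]; ring
    · rw [if_neg (by grind), if_pos (by grind), siteValue_of_odd h]; push_cast; ring

lemma trace_siteMatrix (hn : 1 ≤ n) : (siteMatrix n).trace = if Even n then -1 else 0 := by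
  have hn' : (n : ℝ) ≠ 0 := by positivity
  rw [siteMatrix, Matrix.trace_diagonal, ← Complex.ofReal_sum,
    Fin.sum_univ_eq_sum_range (fun m => siteValue n m), sum_siteValue]
  split_ifs <;> simp [hn']

lemma rank_idealProjection_zero (hn : 1 ≤ n) : (idealProjection n 0).rank = (n + 1) / 2 := by
  have h := rank_eq_trace (isStarProjection_idealProjection hn 0)
  change _ = ((1 / 2 : ℂ) • (1 + siteMatrix n + pathMatrix n evenEdge)).trace at h
  rw [Matrix.trace_smul, Matrix.trace_add, Matrix.trace_add, Matrix.trace_one,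
    trace_siteMatrix hn, trace_pathMatrix_evenEdge hn, Fintype.card_fin, smul_eq_mul] at h
  rcases Nat.even_or_odd n with he | ho
  · rw [if_pos he] at h
    have : ((2 * (idealProjection n 0).rank : ℕ) : ℂ) = (n : ℕ) := by push_cast; rw [h]; ring
    have := Nat.cast_injective this
    grind
  · rw [if_neg (by grind)] at h
    have : ((2 * (idealProjection n 0).rank : ℕ) : ℂ) = (n + 1 : ℕ) := by
      push_cast; rw [h]; ring
    have := Nat.cast_injective this
    grind

lemma rank_idealProjection_one (hn : 1 ≤ n) : (idealProjection n 1).rank = (n - 1) / 2 := by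
  have h := rank_eq_trace (isStarProjection_idealProjection hn 1)
  change _ = ((1 / 2 : ℂ) • (1 + siteMatrix n - pathMatrix n evenEdge)).trace at h
  rw [Matrix.trace_smul, Matrix.trace_sub, Matrix.trace_add, Matrix.trace_one,
    trace_siteMatrix hn, trace_pathMatrix_evenEdge hn, Fintype.card_fin, smul_eq_mul] at h
  rcases Nat.even_or_odd n with he | ho
  · rw [if_pos he] at h
    have : ((2 * (idealProjection n 1).rank + 2 : ℕ) : ℂ) = (n : ℕ) := by push_cast; rw [h]; ring
    have := Nat.cast_injective this
    grind
  · rw [if_neg (by grind)] at h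
    have : ((2 * (idealProjection n 1).rank + 1 : ℕ) : ℂ) = (n : ℕ) := by
      push_cast; rw [h]; ring
    have := Nat.cast_injective this
    grind

lemma rank_one_sub {P : Matrix (Fin n) (Fin n) ℂ} (hP : IsStarProjection P) :
    (1 - P).rank + P.rank = n := by
  have h : (((1 - P).rank + P.rank : ℕ) : ℂ) = (n : ℕ) := by
    push_cast
    rw [rank_eq_trace hP, rank_eq_trace hP.one_sub, Matrix.trace_sub, Matrix.trace_one]
    simp
  exact Nat.cast_injective h

/-- The three admissible ranks are those of the first two ideal projections and of the complement
of the second one. -/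
lemma rank_cases {P : Matrix (Fin n) (Fin n) ℂ} (hn : 1 ≤ n) (hP : IsStarProjection P)
    (hr : (P.rank : ℤ) ∈
      ({⌈(n : ℚ) / 2⌉, ⌊(n : ℚ) / 2⌋ - (-1) ^ n, ⌈(n : ℚ) / 2⌉ + (-1) ^ n} : Set ℤ)) :
    (∃ i, P.rank = (idealProjection n i).rank) ∨ ∃ i, (1 - P).rank = (idealProjection n i).rank := by
  have h1 := rank_one_sub hP
  have h0 := rank_idealProjection_zero hn
  have h2 := rank_idealProjection_one hn
  rw [Set.mem_insert_iff, Set.mem_insert_iff, Set.mem_singleton_iff] at hr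
  rcases Nat.even_or_odd n with he | ho
  · obtain ⟨k, rfl⟩ := he
    have hq : (((k + k : ℕ) : ℚ)) / 2 = ((k : ℤ) : ℚ) := by push_cast; ring
    rw [hq, Int.ceil_intCast, Int.floor_intCast, (Even.add_self k).neg_one_pow] at hr
    rcases hr with hr | hr | hr
    · exact Or.inl ⟨0, by omega⟩
    · exact Or.inl ⟨1, by omega⟩
    · exact Or.inr ⟨1, by omega⟩
  · obtain ⟨k, rfl⟩ := ho
    have hc : ⌈(((2 * k + 1 : ℕ) : ℚ)) / 2⌉ = (k : ℤ) + 1 := by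
      rw [Int.ceil_eq_iff]; push_cast; constructor <;> linarith
    have hf : ⌊(((2 * k + 1 : ℕ) : ℚ)) / 2⌋ = (k : ℤ) := by
      rw [Int.floor_eq_iff]; push_cast; constructor <;> linarith
    rw [hc, hf, (odd_two_mul_add_one k).neg_one_pow] at hr
    rcases hr with hr | hr | hr
    · exact Or.inl ⟨0, by omega⟩
    · exact Or.inl ⟨0, by omega⟩
    · exact Or.inl ⟨1, by omega⟩

/-- A projection with the rank of an ideal projection occurs among the measurements of either
party in a self-tested strategy. -/
lemma exists_selfTested_of_rank_eq (hn : 1 ≤ n) {P : Matrix (Fin n) (Fin n) ℂ}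
    (hP : IsStarProjection P) {i : Fin 4} (hi : P.rank = (idealProjection n i).rank) :
    (∃ S : SquareStrategy 4 2 n, S.HasMaxEntangledState ∧ S.IsSelfTested ∧
      (S.measA i).IsBinaryPVM P) ∧
    (∃ S : SquareStrategy 4 2 n, S.HasMaxEntangledState ∧ S.IsSelfTested ∧
      (S.measB i).IsBinaryPVM P) := by
  obtain ⟨U, hU, hU', hUP⟩ := exists_unitary_conj hP (isStarProjection_idealProjection hn i) hi
  -- The complex conjugate of `U`.
  let W := (star U).transpose
  have hW : star W * W = 1 := by
    have h : star W = U.transpose := by ext; simp [W, Matrix.star_apply]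
    rw [h, ← Matrix.transpose_mul, hU, Matrix.transpose_one]
  have hWU : W * U.transpose = 1 := by
    rw [← Matrix.transpose_mul, hU', Matrix.transpose_one]
  have hUW : U * W.transpose = 1 := by
    rw [Matrix.transpose_transpose, hU']
  have hmeas : ∀ (Q : Matrix (Fin n) (Fin n) ℂ) (hQ : IsStarProjection Q), Q = P →
      (projectivePOVM Q hQ).IsBinaryPVM P := by
    rintro Q hQ rfl
    exact ⟨rfl, rfl⟩
  exact ⟨⟨projectiveStrategy hn _ _ _ _, rfl, isSelfTested_rotated hn hU hW hWU,
      hmeas _ ((isStarProjection_idealProjection hn i).conj_unitary hU) hUP⟩,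
    ⟨projectiveStrategy hn _ _ _ _, rfl, isSelfTested_rotated hn hW hU hUW,
      hmeas _ ((isStarProjection_idealProjection hn i).conj_unitary hU) hUP⟩⟩

end rotation

theorem corollary5p4 (n : ℕ) (hn : 1 ≤ n) :
    (∃ S : SquareStrategy 4 2 n, S.HasMaxEntangledState ∧ S.IsSelfTested) ∧
    (∀ P : Matrix (Fin n) (Fin n) ℂ, IsStarProjection P →
      (P.rank : ℤ) ∈
        ({⌈(n : ℚ) / 2⌉, ⌊(n : ℚ) / 2⌋ - (-1) ^ n, ⌈(n : ℚ) / 2⌉ + (-1) ^ n} : Set ℤ) →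
      (∃ S : SquareStrategy 4 2 n, S.HasMaxEntangledState ∧ S.IsSelfTested ∧
        ∃ i, (S.measA i).IsBinaryPVM P) ∧
      (∃ S : SquareStrategy 4 2 n, S.HasMaxEntangledState ∧ S.IsSelfTested ∧
        ∃ j, (S.measB j).IsBinaryPVM P)) := by
  refine ⟨⟨idealStrategy hn, rfl, BipartiteStrategy.isSelfTested_idealStrategy hn⟩,
    fun P hP hr => ?_⟩
  rcases rank_cases hn hP hr with ⟨i, hi⟩ | ⟨i, hi⟩
  · obtain ⟨⟨S, h1, h2, h3⟩, ⟨S', h1', h2', h3'⟩⟩ := exists_selfTested_of_rank_eq hn hP hi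
    exact ⟨⟨S, h1, h2, i, h3⟩, ⟨S', h1', h2', i, h3'⟩⟩
  · -- Apply the rank condition to `1 - P` and exchange the outcomes.
    obtain ⟨⟨S, h1, h2, h3, h4⟩, ⟨S', h1', h2', h3', h4'⟩⟩ :=
      exists_selfTested_of_rank_eq hn hP.one_sub hi
    rw [sub_sub_cancel] at h4 h4'
    exact ⟨⟨S.swapOutcomes, h1, h2.swapOutcomes, i, h4, h3⟩,
      ⟨S'.swapOutcomes, h1', h2'.swapOutcomes, i, h4', h3'⟩⟩
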